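/- **Theorem 2.** Let $A\in\mathbb R^{d\times d}$ be symmetric, $b\in\mathbb R^d$, $\rho>0$, and $f(x)=\tfrac12x^{\top}Ax+b^{\top}x+\tfrac{\rho}{3}\|x\|^3$ (Euclidean norm). Let $s$ be a global minimizer of $f$, let $\beta=\|A\|_{\rm op}$, $\gamma=-\lambda_{\min}(A)$, and let $\mathrm{gap}$ be the difference between the second smallest and the smallest distinct eigenvalue of $A$ ($+\infty$ if $A$ has only one distinct eigenvalue). If $\gamma>0$, assume $d>2$. Let the step size satisfy $$0<\eta\le\frac1{4(\beta+\rho R)},\qquad R=\frac{\beta}{2\rho}+\sqrt{\Big(\frac{\beta}{2\rho}\Big)^2+\frac{\|b\|}{\rho}}.$$ Let $0<\varepsilon\le\tfrac12\beta\|s\|^2+\rho\|s\|^3$, $\delta>0$, $0<\bar\sigma\le1$, let $q$ be uniformly distributed on the unit sphere of $\mathbb R^d$, and put $$\tilde b=b+\sigma q,\qquad \sigma=\frac{\rho\varepsilon}{\beta+2\rho\|s\|}\cdot\frac{\bar\sigma}{12},\qquad \tilde f(x)=\tfrac12x^{\top}Ax+\tilde b^{\top}x+\tfrac{\rho}{3}\|x\|^3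 .$$ Let $\tilde x_0=-r\,\tilde b/\|\tilde b\|$ with $0\le r\le\tilde R_c$ (and $\tilde x_0=0$ if $\tilde b=0$), where $$\tilde R_c=-\frac{\tilde b^{\top}A\tilde b}{2\rho\|\tilde b\|^2}+\sqrt{\Big(\frac{\tilde b^{\top}A\tilde b}{2\rho\|\tilde b\|^2}\Big)^2+\frac{\|\tilde b\|}{\rho}},$$ and $\tilde x_{t+1}=\tilde x_t-\eta\nabla\tilde f(\tilde x_t)$ for $t\ge0$. Define $$\tilde\tau_{\rm grow}=6\log\Big(1+\mathbb 1_{\{\gamma>0\}}\frac{3\sqrt d}{\bar\sigma\delta}\Big),\qquad \tilde\tau_{\rm conv}=14\log\frac{(\beta+2\rho\|s\|)\|s\|^2}{\varepsilon}.$$ Then there is an event of probability at least $1-\delta$ on which the following holds for every admissible $r$ (in particular $r$ may depend on $q$). First, $f(\tilde x_t)\le f(s)+(1+\bar\sigma)\varepsilon$ for all integers $$t\ge\tilde T_\varepsilon=\frac{1+\bar\sigma}{\eta}\big(\tilde\tau_{\rm grow}+\tilde\tau_{\rm conv}\big)\min\Big\{\frac1{\rho\|s\|-\gamma},\frac{10\|s\|^2}{\varepsilon}\Big\}$$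 (with $1/0=+\infty$). Second, if $\rho\|s\|-\gamma\le(1-\tfrac23\bar\sigma)\frac{\varepsilon}{10\|s\|^2}$, then $f(\tilde x_t)\le f(s)+(1+\bar\sigma)\varepsilon$ for all integers $$t\ge\tilde T'_\varepsilon=\frac{1+\bar\sigma}{\eta}\big(\tilde\tau_{\rm grow}+\tilde\tau_{\rm conv}\big)\sqrt{\frac{10\|s\|^2}{\varepsilon}\cdot\frac1{\min\{\mathrm{gap},\rho\|s\|\}}}.$$ -/

import Mathlib

open MeasureTheory
open scoped ENNReal

noncomputable section

namespace CubicReg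

/-- The cubic-regularized quadratic `f(x) = xᵀAx/2 + bᵀx + (ρ/3)‖x‖³` on `ℝ^d`
(Euclidean norm). -/
def objective {d : ℕ} (A : Matrix (Fin d) (Fin d) ℝ) (b : EuclideanSpace ℝ (Fin d)) (ρ : ℝ)
    (x : EuclideanSpace ℝ (Fin d)) : ℝ :=
  (1 / 2) * inner ℝ x (Matrix.toEuclideanCLM (𝕜 := ℝ) A x) + inner ℝ b x + ρ / 3 * ‖x‖ ^ 3

/-- `β = ‖A‖`, the `ℓ₂`-operator norm. -/
def beta {d : ℕ} (A : Matrix (Fin d) (Fin d) ℝ) : ℝ :=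
  ‖Matrix.toEuclideanCLM (𝕜 := ℝ) A‖

/-- The smallest eigenvalue of the symmetric matrix `A`
(its real spectrum is the finite set of its eigenvalues). -/
def minEigenvalue {d : ℕ} (A : Matrix (Fin d) (Fin d) ℝ) : ℝ :=
  sInf (spectrum ℝ A)

/-- `γ = -λ⁽¹⁾(A)`. -/
def gamma {d : ℕ} (A : Matrix (Fin d) (Fin d) ℝ) : ℝ :=
  -minEigenvalue A

/-- The eigengap: the distance from the smallest eigenvalue of `A` to the next larger one. It is
`∞` when `A` has only one distinct eigenvalue. -/
def eigengap {d : ℕ} (A : Matrix (Fin d) (Fin d) ℝ) : ℝ≥0∞ :=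
  ⨅ μ ∈ {μ : ℝ | μ ∈ spectrum ℝ A ∧ minEigenvalue A < μ}, ENNReal.ofReal (μ - minEigenvalue A)

/-- The radius `R = β/(2ρ) + √((β/(2ρ))² + ‖b‖/ρ)` in the step-size condition. -/
def radius {d : ℕ} (A : Matrix (Fin d) (Fin d) ℝ) (b : EuclideanSpace ℝ (Fin d)) (ρ : ℝ) : ℝ :=
  beta A / (2 * ρ) + Real.sqrt ((beta A / (2 * ρ)) ^ 2 + ‖b‖ / ρ)

/-- The Cauchy radius `R_c = -bᵀAb/(2ρ‖b‖²) + √((bᵀAb/(2ρ‖b‖²))² + ‖b‖/ρ)`. -/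
def cauchyRadius {d : ℕ} (A : Matrix (Fin d) (Fin d) ℝ) (b : EuclideanSpace ℝ (Fin d))
    (ρ : ℝ) : ℝ :=
  -inner ℝ b (Matrix.toEuclideanCLM (𝕜 := ℝ) A b) / (2 * ρ * ‖b‖ ^ 2) +
    Real.sqrt ((inner ℝ b (Matrix.toEuclideanCLM (𝕜 := ℝ) A b) / (2 * ρ * ‖b‖ ^ 2)) ^ 2 + ‖b‖ / ρ)

/-- Gradient descent on `objective A b ρ` with fixed step size `η`, started at `-r b/‖b‖`. -/
def gdIterate {d : ℕ} (A : Matrix (Fin d) (Fin d) ℝ) (b : EuclideanSpace ℝ (Fin d))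
    (ρ η r : ℝ) : ℕ → EuclideanSpace ℝ (Fin d)
  | 0 => -((r / ‖b‖) • b)
  | t + 1 => gdIterate A b ρ η r t - η • gradient (objective A b ρ) (gdIterate A b ρ η r t)

/-- The perturbation size `σ = ρε/(β + 2ρ‖s‖) · σ̄/12`. -/
def pertSize {d : ℕ} (A : Matrix (Fin d) (Fin d) ℝ) (ρ : ℝ) (s : EuclideanSpace ℝ (Fin d))
    (ε σbar : ℝ) : ℝ :=
  ρ * ε / (beta A + 2 * ρ * ‖s‖) * (σbar / 12)

/-- The growth term `6 log(1 + 1_{γ>0} · 3√d/(σ̄δ))`. -/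
def growTerm {d : ℕ} (A : Matrix (Fin d) (Fin d) ℝ) (δ σbar : ℝ) : ℝ :=
  6 * Real.log (1 + if 0 < gamma A then 3 * Real.sqrt d / (σbar * δ) else 0)

/-- The convergence term `14 log((β + 2ρ‖s‖)‖s‖²/ε)`. -/
def convTerm {d : ℕ} (A : Matrix (Fin d) (Fin d) ℝ) (ρ : ℝ) (s : EuclideanSpace ℝ (Fin d))
    (ε : ℝ) : ℝ :=
  14 * Real.log ((beta A + 2 * ρ * ‖s‖) * ‖s‖ ^ 2 / ε)

/-- `min {1/(ρ‖s‖ - γ), 10‖s‖²/ε}`, where `1/0` stands for `+∞`. -/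
def rateFactor {d : ℕ} (A : Matrix (Fin d) (Fin d) ℝ) (ρ : ℝ) (s : EuclideanSpace ℝ (Fin d))
    (ε : ℝ) : ℝ :=
  if ρ * ‖s‖ - gamma A = 0 then 10 * ‖s‖ ^ 2 / ε
  else min (1 / (ρ * ‖s‖ - gamma A)) (10 * ‖s‖ ^ 2 / ε)

/-- `min {gap, ρ‖s‖}` as a real number. -/
def gapMin {d : ℕ} (A : Matrix (Fin d) (Fin d) ℝ) (ρ : ℝ) (s : EuclideanSpace ℝ (Fin d)) : ℝ :=
  (min (eigengap A) (ENNReal.ofReal (ρ * ‖s‖))).toReal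

/-- The iteration bound. -/
def iterBound {d : ℕ} (A : Matrix (Fin d) (Fin d) ℝ) (ρ : ℝ) (s : EuclideanSpace ℝ (Fin d))
    (η ε δ σbar : ℝ) : ℝ :=
  (1 + σbar) / η * (growTerm A δ σbar + convTerm A ρ s ε) * rateFactor A ρ s ε

/-- The gap-dependent iteration bound. -/
def gapIterBound {d : ℕ} (A : Matrix (Fin d) (Fin d) ℝ) (ρ : ℝ) (s : EuclideanSpace ℝ (Fin d))
    (η ε δ σbar : ℝ) : ℝ :=
  (1 + σbar) / η * (growTerm A δ σbar + convTerm A ρ s ε) *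
    Real.sqrt (10 * ‖s‖ ^ 2 / ε * (1 / gapMin A ρ s))

end CubicReg

end

/-! Freeze the perturbed vector b' = b + σq and work in an orthonormal eigenbasis of A; write f̃ for
the cubic of b'. If the start lies on the ray -ℝ₊b' and the gradient there does not point outward,
every coordinate of every iterate is a nonpositive multiple of that of b', and relative increments
are ordered by the eigenvalues. This pattern propagates ⟨x_t, ∇f̃(x_t)⟩ ≤ 0 and makes ‖x_t‖
nondecreasing (`coordPattern_step`, `gradientDescent_norm_mono`).

The iterates are compared not with a minimizer of f̃ but with a vector s', obtained from s by giving
each eigencoordinate the sign opposite to that of b' (`exists_reference`). It has the norm of s, so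
A + ρ‖s'‖ is the same positive semidefinite matrix; it is critical for f̃ up to σ, and ⟨x_t, s'⟩ ≥
0. Hence the rates are those of the unperturbed problem, and returning to f costs only O(σ‖s‖)
(`cubic_le_of_reference`).

Up to the small gradient at s', ⟨x - s', ∇f̃(x)⟩ is a nonnegative quantity minus (ρ/2)(‖s'‖ -
‖x‖)₊‖x - s'‖², so short iterates are the only obstruction. With m = ρ‖s‖ - γ, geometric growth
along the lowest eigenvector yields ρ(‖s‖ - ‖x_t‖) ≤ m + δ' (`IsDescent.growth`), permanently since
norms increase; for γ ≤ 0 this is trivial. Then ‖x - s'‖² + (3/2)η(f̃(x) - f̃(s')) contracts at a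
rate proportional to m or to ε/(10‖s‖²) (`IsDescent.exp_le`, `IsDescent.cubic_sub_le_of_growth`).

With a gap g the rate is μ = √(εg/(10‖s‖²)). Either ‖x_t‖ exceeds ‖s‖ by μ/ρ, which supplies the
missing convexity, or the norm stays in a window where the higher coordinates contract, while the
lowest eigenspace costs only O(m‖s‖²) = O(ε) (`IsDescent.cubic_sub_le_of_growth_of_gap`).

Randomness enters only for γ > 0, to bound |⟨u, b'⟩| below for a lowest eigenvector u. A coordinate
of a uniform unit vector lies in an interval of half-length a with probability at most 2a√d
(`cond_toSphere_band_le`), by comparing volumes of a cone and the ball. -/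

namespace CubicReg

/-! ### Second-order expansion of the cubic and optimality conditions. -/

section Cubic

variable {E : Type*} [NormedAddCommGroup E] [InnerProductSpace ℝ E]

/-- The cubic-regularized quadratic of a bounded operator `T`. -/
noncomputable def cubic (T : E →L[ℝ] E) (b : E) (ρ : ℝ) (x : E) : ℝ :=
  (1 / 2) * inner ℝ x (T x) + inner ℝ b x + ρ / 3 * ‖x‖ ^ 3

/-- The gradient of `cubic T b ρ` for symmetric `T`. -/
noncomputable def cubicGrad (T : E →L[ℝ] E) (b : E) (ρ : ℝ) (x : E) : E :=
  T x + b + (ρ * ‖x‖) • x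

/-- The remainder of the second-order expansion of the cubic at a point `x`. -/
theorem cubic_expand {T : E →L[ℝ] E} (hT : ∀ x y, inner ℝ (T x) y = inner ℝ x (T y))
    (b : E) (ρ : ℝ) (x y : E) :
    cubic T b ρ y = cubic T b ρ x + inner ℝ (cubicGrad T b ρ x) (y - x)
      + (1 / 2) * (inner ℝ (y - x) (T (y - x)) + ρ * ‖x‖ * ‖y - x‖ ^ 2)
      + ρ / 6 * (‖y‖ - ‖x‖) ^ 2 * (‖x‖ + 2 * ‖y‖) := by
  have h1 : ‖y - x‖ ^ 2 = ‖y‖ ^ 2 - 2 * inner ℝ x y + ‖x‖ ^ 2 := by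
    rw [norm_sub_sq_real, real_inner_comm]
  have h2 : inner ℝ y (T x) = inner ℝ x (T y) := by
    rw [← hT x y, real_inner_comm]
  have h3 : inner ℝ (T x) x = inner ℝ x (T x) := hT x x
  have h4 : inner ℝ (T x) y = inner ℝ x (T y) := hT x y
  rw [h1]
  simp only [cubic, cubicGrad, inner_add_left, inner_sub_right, inner_sub_left, map_sub,
    real_inner_smul_left, real_inner_self_eq_norm_sq, h2, h3, h4]
  ring

theorem abs_inner_apply_le {T : E →L[ℝ] E} {β : ℝ} (hβ : ‖T‖ ≤ β) (x : E) :
    |inner ℝ x (T x)| ≤ β * ‖x‖ ^ 2 := by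
  have h1 := abs_real_inner_le_norm x (T x)
  have h2 := T.le_of_opNorm_le hβ x
  nlinarith [norm_nonneg x]

/-- Descent along a gradient step whose endpoints have norm at most `B`. -/
theorem cubic_descent {T : E →L[ℝ] E} (hT : ∀ x y, inner ℝ (T x) y = inner ℝ x (T y))
    {β : ℝ} (hβ : ‖T‖ ≤ β) {b : E} {ρ η B : ℝ} (hρ : 0 < ρ) (hη : 0 < η)
    (hB : 3 * (η * (β + ρ * B)) ≤ 1) {x : E} (hx : ‖x‖ ≤ B)
    (hy : ‖x - η • cubicGrad T b ρ x‖ ≤ B) :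
    2 / 3 * η * ‖cubicGrad T b ρ x‖ ^ 2 ≤
      cubic T b ρ x - cubic T b ρ (x - η • cubicGrad T b ρ x) := by
  set g := cubicGrad T b ρ x with hg
  set y := x - η • g with hydef
  have hyx : y - x = -(η • g) := by rw [hydef]; abel
  have hn : ‖y - x‖ = η * ‖g‖ := by rw [hyx, norm_neg, norm_smul, Real.norm_of_nonneg hη.le]
  have h1 := cubic_expand hT b ρ x y
  rw [← hg] at h1
  have h2 : inner ℝ g (y - x) = -(η * ‖g‖ ^ 2) := by
    rw [hyx, inner_neg_right, real_inner_smul_right, real_inner_self_eq_norm_sq]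
  have h3 := (abs_le.1 (abs_inner_apply_le hβ (y - x))).2
  have h4 : (‖y‖ - ‖x‖) ^ 2 ≤ ‖y - x‖ ^ 2 := by
    have := abs_norm_sub_norm_le y x
    exact sq_le_sq' (by linarith [neg_abs_le (‖y‖ - ‖x‖), norm_nonneg (y - x)])
      (by linarith [le_abs_self (‖y‖ - ‖x‖)])
  have hx0 := norm_nonneg x
  have hy0 := norm_nonneg y
  have hB0 : 0 ≤ B := hx0.trans hx
  have h5 : ρ / 6 * (‖y‖ - ‖x‖) ^ 2 * (‖x‖ + 2 * ‖y‖) ≤ ρ / 6 * ‖y - x‖ ^ 2 * (3 * B) := by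
    gcongr
    linarith
  have h6 : ρ * ‖x‖ * ‖y - x‖ ^ 2 ≤ ρ * B * ‖y - x‖ ^ 2 := by gcongr
  have hβ0 : 0 ≤ β := (norm_nonneg T).trans hβ
  -- The quadratic and cubic remainders add up to at most (β + 2ρB)‖y - x‖²/2, hence to a third of
  -- η‖g‖².
  have h7 : η * (β + 2 * ρ * B) ≤ 2 / 3 := by nlinarith [mul_nonneg hη.le hβ0]
  rw [hn] at h3 h5 h6
  rw [hn, h2] at h1
  have h8 : η * (β + 2 * ρ * B) * (η * ‖g‖ ^ 2) ≤ 2 / 3 * (η * ‖g‖ ^ 2) := by gcongr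
  nlinarith

theorem hasGradientAt_cubic [CompleteSpace E] {T : E →L[ℝ] E}
    (hT : ∀ x y, inner ℝ (T x) y = inner ℝ x (T y)) (b : E) {ρ : ℝ} (hρ : 0 < ρ) (x : E) :
    HasGradientAt (cubic T b ρ) (cubicGrad T b ρ x) x := by
  rw [hasGradientAt_iff_isLittleO]
  set C := 1 / 2 * (‖T‖ + ρ * ‖x‖) + ρ / 6 * (3 * ‖x‖ + 2) with hC
  have hO : (fun y => cubic T b ρ y - cubic T b ρ x - inner ℝ (cubicGrad T b ρ x) (y - x))
      =O[nhds x] fun y => ‖y - x‖ ^ 2 := by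
    refine Asymptotics.IsBigO.of_bound C ?_
    filter_upwards [Metric.ball_mem_nhds x one_pos] with y hy
    rw [mem_ball_iff_norm] at hy
    have h1 := cubic_expand hT b ρ x y
    have h3 := abs_le.1 (abs_inner_apply_le le_rfl (y - x) : |inner ℝ (y - x) (T (y - x))| ≤ _)
    have h4 := abs_norm_sub_norm_le y x
    have h5 : (‖y‖ - ‖x‖) ^ 2 ≤ ‖y - x‖ ^ 2 :=
      sq_le_sq' (by linarith [neg_abs_le (‖y‖ - ‖x‖)]) (by linarith [le_abs_self (‖y‖ - ‖x‖)])
    have h6 : ‖y‖ ≤ ‖x‖ + 1 := by linarith [le_abs_self (‖y‖ - ‖x‖)]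
    have h7 : ρ / 6 * (‖y‖ - ‖x‖) ^ 2 * (‖x‖ + 2 * ‖y‖) ≤
        ρ / 6 * ‖y - x‖ ^ 2 * (3 * ‖x‖ + 2) :=
      mul_le_mul (by gcongr) (by linarith) (by positivity) (by positivity)
    have h8 : 0 ≤ ρ / 6 * (‖y‖ - ‖x‖) ^ 2 * (‖x‖ + 2 * ‖y‖) := by positivity
    have h9 : 0 ≤ ρ * ‖x‖ * ‖y - x‖ ^ 2 := by positivity
    have h10 : 0 ≤ ρ / 6 * ‖y - x‖ ^ 2 * (3 * ‖x‖ + 2) := by positivity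
    rw [Real.norm_eq_abs, Real.norm_of_nonneg (by positivity), abs_le, hC]
    constructor <;> nlinarith
  refine hO.trans_isLittleO ?_
  have : Filter.Tendsto (fun y => ‖y - x‖) (nhds x) (nhds 0) := by
    have : Continuous fun y => ‖y - x‖ := by fun_prop
    simpa using this.tendsto x
  have h2 := (Asymptotics.isLittleO_one_iff ℝ).2 this
  have h3 := h2.mul_isBigO (Asymptotics.isBigO_refl (fun y => ‖y - x‖) (nhds x))
  refine Asymptotics.IsLittleO.of_norm_right ?_
  simpa [sq] using h3

/-- A global minimizer of the cubic is a critical point. -/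
theorem cubicGrad_eq_zero [CompleteSpace E] {T : E →L[ℝ] E}
    (hT : ∀ x y, inner ℝ (T x) y = inner ℝ x (T y)) {b : E} {ρ : ℝ} (hρ : 0 < ρ) {s : E}
    (hs : ∀ x, cubic T b ρ s ≤ cubic T b ρ x) : cubicGrad T b ρ s = 0 := by
  have h1 : IsLocalMin (cubic T b ρ) s := Filter.Eventually.of_forall hs
  have h2 := h1.hasFDerivAt_eq_zero (hasGradientAt_cubic hT b hρ s).hasFDerivAt
  simpa using h2

/-- At a nonzero global minimizer `s` of the cubic, `T + ρ‖s‖` is positive semidefinite. -/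
theorem eigenvalue_add_nonneg [CompleteSpace E] {T : E →L[ℝ] E}
    (hT : ∀ x y, inner ℝ (T x) y = inner ℝ x (T y)) {b : E} {ρ : ℝ} (hρ : 0 < ρ) {s : E}
    (hs : ∀ x, cubic T b ρ s ≤ cubic T b ρ x) (hs0 : s ≠ 0) {w : E} (hw : ‖w‖ = 1) {a : ℝ}
    (ha : inner ℝ w (T w) = a) : 0 ≤ a + ρ * ‖s‖ := by
  have hg := cubicGrad_eq_zero hT hρ hs
  have key : ∀ τ : ℝ, 0 ≤ (1 / 2) * τ ^ 2 * (a + ρ * ‖s‖)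
      + ρ / 6 * (‖s + τ • w‖ - ‖s‖) ^ 2 * (‖s‖ + 2 * ‖s + τ • w‖) := by
    intro τ
    have h1 := cubic_expand hT b ρ s (s + τ • w)
    have h2 := hs (s + τ • w)
    rw [hg, add_sub_cancel_left, inner_zero_left, map_smul, real_inner_smul_left,
      real_inner_smul_right, ha, norm_smul, hw, mul_one, Real.norm_eq_abs, sq_abs] at h1
    nlinarith
  have hn : 0 < ‖s‖ := norm_pos_iff.2 hs0
  have hnorm : ∀ τ : ℝ, ‖s + τ • w‖ ^ 2 = ‖s‖ ^ 2 + 2 * τ * inner ℝ s w + τ ^ 2 := by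
    intro τ
    rw [norm_add_sq_real, real_inner_smul_right, norm_smul, hw, mul_one, Real.norm_eq_abs, sq_abs]
    ring
  -- If w ⟂ s, moving by τw changes the norm by O(τ²), so the cubic remainder is O(τ⁴) and cannot
  -- offset a negative τ² term. Otherwise reflecting s in the hyperplane orthogonal to w keeps the
  -- norm, and the remainder vanishes.
  by_cases hsw : inner ℝ s w = 0
  · by_contra hneg
    push Not at hneg
    set c := -(a + ρ * ‖s‖) with hc
    have hc0 : 0 < c := by linarith
    obtain ⟨τ, hτ0, hτn, hτc⟩ : ∃ τ : ℝ, 0 < τ ∧ τ ≤ ‖s‖ ∧ ρ * τ ^ 2 < 2 * c * ‖s‖ := by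
      refine ⟨min ‖s‖ (c / ρ), lt_min hn (by positivity), min_le_left _ _, ?_⟩
      have h1 : min ‖s‖ (c / ρ) ^ 2 ≤ ‖s‖ * (c / ρ) := by
        rw [sq]
        exact mul_le_mul (min_le_left _ _) (min_le_right _ _)
          (le_min hn.le (by positivity)) hn.le
      have h2 : ρ * (‖s‖ * (c / ρ)) = c * ‖s‖ := by field_simp
      nlinarith [mul_pos hc0 hn]
    have h1 := key τ
    have h2 := hnorm τ
    rw [hsw, mul_zero, add_zero] at h2
    set N := ‖s + τ • w‖ with hN
    have hN0 : 0 ≤ N := norm_nonneg _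
    have hNn : ‖s‖ ≤ N := by nlinarith
    have hN2 : N ≤ 2 * ‖s‖ := by nlinarith
    have h3 : (N - ‖s‖) * (2 * ‖s‖) ≤ τ ^ 2 := by nlinarith
    have h4 : (N - ‖s‖) ^ 2 * (2 * ‖s‖) ^ 2 ≤ τ ^ 4 := by
      rw [← mul_pow, show τ ^ 4 = (τ ^ 2) ^ 2 by ring]
      exact pow_le_pow_left₀ (by nlinarith) h3 2
    have h5 : ρ / 6 * (N - ‖s‖) ^ 2 * (‖s‖ + 2 * N) ≤ ρ / 6 * (N - ‖s‖) ^ 2 * (5 * ‖s‖) := by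
      gcongr
      linarith
    have h6 : 0 ≤ -(1 / 2) * τ ^ 2 * c + ρ / 6 * (N - ‖s‖) ^ 2 * (5 * ‖s‖) := by
      rw [hc]; nlinarith
    have h7 : ρ * ((N - ‖s‖) ^ 2 * (2 * ‖s‖) ^ 2) ≤ ρ * τ ^ 4 := by gcongr
    have h8 : 0 ≤ (-(1 / 2) * τ ^ 2 * c + ρ / 6 * (N - ‖s‖) ^ 2 * (5 * ‖s‖)) * (24 * ‖s‖) := by
      positivity
    have h9 : 0 ≤ τ ^ 2 * (5 * (ρ * τ ^ 2) - 12 * c * ‖s‖) := by nlinarith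
    have h10 := nonneg_of_mul_nonneg_right h9 (by positivity)
    nlinarith [mul_pos hc0 hn]
  · have h1 := key (-2 * inner ℝ s w)
    have h2 := hnorm (-2 * inner ℝ s w)
    have h3 : ‖s + (-2 * inner ℝ s w) • w‖ = ‖s‖ := by
      refine (pow_left_inj₀ (norm_nonneg _) (norm_nonneg _) two_ne_zero).1 ?_
      rw [h2]; ring
    rw [h3] at h1
    have h4 : 0 < (1 / 2) * (-2 * inner ℝ s w) ^ 2 := by positivity
    by_contra hneg
    push Not at hneg
    nlinarith [mul_neg_of_pos_of_neg h4 hneg]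

end Cubic

/-! ### Eigenbasis coordinates and monotonicity of the iterate norms. -/

section Eigenbasis

variable {E ι : Type*} [NormedAddCommGroup E] [InnerProductSpace ℝ E] [Fintype ι]

theorem inner_eq_sum_coord (u : OrthonormalBasis ι ℝ E) (x y : E) :
    inner ℝ x y = ∑ i, inner ℝ (u i) x * inner ℝ (u i) y := by
  rw [← u.sum_inner_mul_inner x y]
  exact Finset.sum_congr rfl fun i _ => by rw [real_inner_comm]

theorem norm_sq_eq_sum_coord (u : OrthonormalBasis ι ℝ E) (x : E) :
    ‖x‖ ^ 2 = ∑ i, inner ℝ (u i) x ^ 2 := by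
  rw [← real_inner_self_eq_norm_sq, inner_eq_sum_coord u]
  exact Finset.sum_congr rfl fun i _ => (sq _).symm

theorem abs_coord_le (u : OrthonormalBasis ι ℝ E) (i : ι) (x : E) :
    |inner ℝ (u i) x| ≤ ‖x‖ := by
  simpa using abs_real_inner_le_norm (u i) x

theorem symmetric_of_coord {T : E →L[ℝ] E} {u : OrthonormalBasis ι ℝ E} {l : ι → ℝ}
    (hT : ∀ i x, inner ℝ (u i) (T x) = l i * inner ℝ (u i) x) (x y : E) :
    inner ℝ (T x) y = inner ℝ x (T y) := by
  rw [inner_eq_sum_coord u, inner_eq_sum_coord u]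
  exact Finset.sum_congr rfl fun i _ => by rw [hT, hT]; ring

theorem inner_apply_eq_sum {T : E →L[ℝ] E} {u : OrthonormalBasis ι ℝ E} {l : ι → ℝ}
    (hT : ∀ i x, inner ℝ (u i) (T x) = l i * inner ℝ (u i) x) (x : E) :
    inner ℝ x (T x) = ∑ i, l i * inner ℝ (u i) x ^ 2 := by
  rw [inner_eq_sum_coord u]
  exact Finset.sum_congr rfl fun i _ => by rw [hT]; ring

theorem abs_eigenvalue_le {T : E →L[ℝ] E} {u : OrthonormalBasis ι ℝ E} {l : ι → ℝ}
    (hT : ∀ i x, inner ℝ (u i) (T x) = l i * inner ℝ (u i) x) {β : ℝ} (hβ : ‖T‖ ≤ β) (i : ι) :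
    |l i| ≤ β := by
  have h := abs_inner_apply_le hβ (u i)
  rwa [hT, real_inner_self_eq_norm_sq, u.norm_eq_one, one_pow, mul_one, mul_one] at h

theorem mul_norm_sq_le_inner_apply {T : E →L[ℝ] E} {u : OrthonormalBasis ι ℝ E} {l : ι → ℝ}
    (hT : ∀ i x, inner ℝ (u i) (T x) = l i * inner ℝ (u i) x) {m a : ℝ}
    (hm : ∀ i, m ≤ l i + a) (x : E) :
    m * ‖x‖ ^ 2 ≤ inner ℝ x (T x) + a * ‖x‖ ^ 2 := by
  rw [inner_apply_eq_sum hT, norm_sq_eq_sum_coord u, Finset.mul_sum, Finset.mul_sum,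
    ← Finset.sum_add_distrib]
  refine Finset.sum_le_sum fun i _ => ?_
  nlinarith [hm i, sq_nonneg (inner ℝ (u i) x)]

theorem coord_cubicGrad {T : E →L[ℝ] E} {u : OrthonormalBasis ι ℝ E} {l : ι → ℝ}
    (hT : ∀ i x, inner ℝ (u i) (T x) = l i * inner ℝ (u i) x) (b : E) (ρ : ℝ) (i : ι) (x : E) :
    inner ℝ (u i) (cubicGrad T b ρ x)
      = (l i + ρ * ‖x‖) * inner ℝ (u i) x + inner ℝ (u i) b := by
  rw [cubicGrad, inner_add_right, inner_add_right, hT, real_inner_smul_right]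
  ring

/-- The hypothesis gives ρ‖x‖² ≤ β‖x‖ + ‖b‖ for x ≠ 0, and B is at or beyond the larger root of this
quadratic. -/
theorem norm_le_of_inner_cubicGrad_nonpos {T : E →L[ℝ] E} {β : ℝ} (hβ : ‖T‖ ≤ β) {b : E}
    {ρ B : ℝ} (hρ : 0 < ρ) (hB0 : 0 < B) (hB : β * B + ‖b‖ ≤ ρ * B ^ 2) {x : E}
    (hx : inner ℝ x (cubicGrad T b ρ x) ≤ 0) : ‖x‖ ≤ B := by
  rw [cubicGrad, inner_add_right, inner_add_right, real_inner_smul_right,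
    real_inner_self_eq_norm_sq] at hx
  have h1 := (abs_le.1 (abs_inner_apply_le hβ x)).1
  have h2 := (abs_le.1 (abs_real_inner_le_norm x b)).1
  by_contra hlt
  push Not at hlt
  have hx0 : 0 < ‖x‖ := hB0.trans hlt
  have h3 : 0 ≤ ‖x‖ * (β * ‖x‖ + ‖b‖ - ρ * ‖x‖ ^ 2) := by nlinarith
  have h4 := nonneg_of_mul_nonneg_right h3 hx0
  have h5 : 0 ≤ B * (ρ * B - β) := by nlinarith [norm_nonneg b]
  have h6 := nonneg_of_mul_nonneg_right h5 hB0
  have h7 : B * (ρ * B - β) ≤ B * (ρ * ‖x‖ - β) := by gcongr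
  have h8 : 0 < ρ * ‖x‖ - β := by nlinarith
  nlinarith [mul_pos (sub_pos.2 hlt) h8]

/-- A common multiplier below which a family decreasing in `l` can be replaced, for weights whose
sign pattern is decreasing in `l`. -/
theorem exists_common_multiplier (l w : ι → ℝ) {η a β : ℝ} (hη : 0 ≤ η) (hl : ∀ i, |l i| ≤ β)
    (hβ : 0 ≤ β) (hw : ∀ i j, l i ≤ l j → 0 < w j → 0 < w i) :
    ∃ k, 1 - η * (β + a) ≤ k ∧ ∀ i, k * w i ≤ (1 - η * (l i + a)) * w i := by
  classical
  by_cases hne : (Finset.univ.filter fun i => 0 < w i).Nonempty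
  -- The multiplier of the largest eigenvalue carrying positive weight works: positive weights sit
  -- at or below it, the others at or above.
  · obtain ⟨j, hj, hmax⟩ := Finset.exists_max_image _ l hne
    have hjw : 0 < w j := (Finset.mem_filter.1 hj).2
    refine ⟨1 - η * (l j + a), ?_, fun i => ?_⟩
    · nlinarith [(abs_le.1 (hl j)).2]
    · rcases lt_or_ge 0 (w i) with hi | hi
      · have := hmax i (by simp [hi])
        have h2 : 1 - η * (l j + a) ≤ 1 - η * (l i + a) := by nlinarith
        exact mul_le_mul_of_nonneg_right h2 hi.le
      · have : l j ≤ l i := by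
          by_contra hlt
          exact absurd (hw i j (not_le.1 hlt).le hjw) (not_lt.2 hi)
        have h2 : 1 - η * (l i + a) ≤ 1 - η * (l j + a) := by nlinarith
        exact mul_le_mul_of_nonpos_right h2 hi
  · refine ⟨1 - η * (-β + a), by nlinarith [mul_nonneg hη hβ], fun i => ?_⟩
    have hi : w i ≤ 0 := by
      by_contra hlt
      exact hne ⟨i, by simpa using hlt⟩
    have h2 : 1 - η * (l i + a) ≤ 1 - η * (-β + a) := by nlinarith [(abs_le.1 (hl i)).1]
    exact mul_le_mul_of_nonpos_right h2 hi

/-- The coordinates of a gradient descent iterate are nonpositive multiples `-η z` of those of `b`,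
and the increments of `z` are, relative to `z`, ordered by the eigenvalues wherever positive. -/
def CoordPattern (u : OrthonormalBasis ι ℝ E) (l : ι → ℝ) (b : E) (ρ η : ℝ) (x : E)
    (z : ι → ℝ) : Prop :=
  (∀ i, 0 ≤ z i) ∧ (∀ i, inner ℝ (u i) x = -(η * z i) * inner ℝ (u i) b) ∧
    ∀ i j, l i ≤ l j → 0 < 1 - η * (l j + ρ * ‖x‖) * z j →
      0 < 1 - η * (l i + ρ * ‖x‖) * z i ∧
        (1 - η * (l j + ρ * ‖x‖) * z j) * z i ≤ (1 - η * (l i + ρ * ‖x‖) * z i) * z j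

/-- With w the increments of z, the next increments are (1 - η(lᵢ + ρ‖y‖))wᵢ - c zᵢ, where c =
ηρ(‖y‖ - ‖x‖) ≥ 0. The sign pattern of w allows one common multiplier k, whence -η⟨y, ∇f(y)⟩ ≥ k⟨y,
y - x⟩ - c⟨y, x⟩ ≥ (k - ηρ‖x‖)‖y‖(‖y‖ - ‖x‖) ≥ 0. -/
theorem coordPattern_step {T : E →L[ℝ] E} {u : OrthonormalBasis ι ℝ E} {l : ι → ℝ}
    (hT : ∀ i x, inner ℝ (u i) (T x) = l i * inner ℝ (u i) x) {β : ℝ} (hβ : ‖T‖ ≤ β) {b : E}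
    {ρ η B : ℝ} (hρ : 0 < ρ) (hη : 0 < η) (hB0 : 0 < B) (hB : β * B + ‖b‖ ≤ ρ * B ^ 2)
    (hηB : 3 * (η * (β + ρ * B)) ≤ 1) {x : E} {z : ι → ℝ} (hz : CoordPattern u l b ρ η x z)
    (hx : inner ℝ x (cubicGrad T b ρ x) ≤ 0) :
    let y := x - η • cubicGrad T b ρ x
    ‖x‖ ≤ ‖y‖ ∧ inner ℝ y (cubicGrad T b ρ y) ≤ 0 ∧
      CoordPattern u l b ρ η y (fun i => z i + (1 - η * (l i + ρ * ‖x‖) * z i)) := by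
  intro y
  obtain ⟨hz0, hzx, hpat⟩ := hz
  set w : ι → ℝ := fun i => 1 - η * (l i + ρ * ‖x‖) * z i with hw
  have hwi : ∀ i, w i = 1 - η * (l i + ρ * ‖x‖) * z i := fun i => rfl
  have hl := abs_eigenvalue_le hT hβ
  have hβ0 : 0 ≤ β := (norm_nonneg T).trans hβ
  have hxB := norm_le_of_inner_cubicGrad_nonpos hβ hρ hB0 hB hx
  have hyx : y - x = -(η • cubicGrad T b ρ x) := by simp [y]
  have hinc : 0 ≤ inner ℝ x (y - x) := by
    rw [hyx, inner_neg_right, real_inner_smul_right]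
    nlinarith
  have hxy : ‖x‖ ≤ ‖y‖ := by
    have h1 : ‖x‖ * ‖x‖ ≤ ‖x‖ * ‖y‖ := by
      have := real_inner_le_norm x y
      rw [inner_sub_right, real_inner_self_eq_norm_sq] at hinc
      nlinarith
    rcases (norm_nonneg x).eq_or_lt with h0 | h0
    · rw [← h0]; exact norm_nonneg y
    · exact le_of_mul_le_mul_left h1 h0
  -- A crude bound, since ‖y‖ ≤ B is not yet available: the gradient is at most 2ρB², and ηρB ≤ 1/3.
  have hyB : ‖y‖ ≤ 5 / 3 * B := by
    have h1 : ‖y‖ ≤ ‖x‖ + η * ‖cubicGrad T b ρ x‖ := by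
      refine (norm_sub_le _ _).trans ?_
      rw [norm_smul, Real.norm_of_nonneg hη.le]
    have h2 : ‖cubicGrad T b ρ x‖ ≤ β * ‖x‖ + ‖b‖ + ρ * ‖x‖ * ‖x‖ := by
      refine (norm_add_le _ _).trans (add_le_add ((norm_add_le _ _).trans ?_) ?_)
      · gcongr; exact T.le_of_opNorm_le hβ x
      · rw [norm_smul, Real.norm_of_nonneg (by positivity)]
    have h3 : β * ‖x‖ + ‖b‖ + ρ * ‖x‖ * ‖x‖ ≤ β * B + ‖b‖ + ρ * B * B := by gcongr
    have h4 : η * ‖cubicGrad T b ρ x‖ ≤ η * (2 * ρ * B ^ 2) :=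
      mul_le_mul_of_nonneg_left (by nlinarith) hη.le
    have h5 : η * ρ * B ≤ 1 / 3 := by nlinarith [mul_nonneg hη.le hβ0]
    have h6 : η * ρ * B * B ≤ 1 / 3 * B := by gcongr
    nlinarith
  have hη1 : η * (β + ρ * ‖y‖) + η * ρ * ‖x‖ ≤ 8 / 9 := by
    have h1 : η * (β + ρ * ‖y‖) + η * ρ * ‖x‖ ≤
        η * (β + ρ * (5 / 3 * B)) + η * ρ * B := by gcongr
    nlinarith [mul_nonneg hη.le hβ0]
  set c := η * ρ * (‖y‖ - ‖x‖) with hc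
  have hc0 : 0 ≤ c := mul_nonneg (by positivity) (sub_nonneg.2 hxy)
  have hκ0 : ∀ i, 0 ≤ 1 - η * (l i + ρ * ‖y‖) := by
    intro i
    have h1 : η * l i ≤ η * β := by gcongr; exact (abs_le.1 (hl i)).2
    have h2 : 0 ≤ η * ρ * ‖x‖ := by positivity
    nlinarith
  have hκx : ∀ i, 0 ≤ 1 - η * (l i + ρ * ‖x‖) := by
    intro i
    have h1 : η * ρ * ‖x‖ ≤ η * ρ * ‖y‖ := by gcongr
    nlinarith [hκ0 i]
  have hw' : ∀ i, 1 - η * (l i + ρ * ‖y‖) * (z i + w i) =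
      (1 - η * (l i + ρ * ‖y‖)) * w i - c * z i := by
    intro i
    rw [hwi, hc]; ring
  have hzw : ∀ i, 0 ≤ z i + w i := by
    intro i
    rw [hwi]
    nlinarith [mul_nonneg (hκx i) (hz0 i)]
  have hyc : ∀ i, inner ℝ (u i) y = -(η * (z i + w i)) * inner ℝ (u i) b := by
    intro i
    simp only [y, inner_sub_right, real_inner_smul_right, coord_cubicGrad hT, hzx, hwi]
    ring
  have hpat' : CoordPattern u l b ρ η y (fun i => z i + w i) := by
    refine ⟨hzw, hyc, fun i j hij hj => ?_⟩
    simp only [hw'] at hj ⊢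
    have hj0 : 0 < w j := by
      by_contra hneg
      push Not at hneg
      nlinarith [mul_nonneg hc0 (hz0 j), mul_nonpos_of_nonneg_of_nonpos (hκ0 j) hneg]
    obtain ⟨hi0, hcr⟩ := hpat i j hij hj0
    have hκij : 1 - η * (l j + ρ * ‖y‖) ≤ 1 - η * (l i + ρ * ‖y‖) := by nlinarith
    have hcross : ((1 - η * (l j + ρ * ‖y‖)) * w j - c * z j) * (z i + w i) ≤
        ((1 - η * (l i + ρ * ‖y‖)) * w i - c * z i) * (z j + w j) := by
      have e : ((1 - η * (l i + ρ * ‖y‖)) * w i - c * z i) * (z j + w j) -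
          ((1 - η * (l j + ρ * ‖y‖)) * w j - c * z j) * (z i + w i) =
          (1 - η * (l j + ρ * ‖y‖) + c) * (w i * z j - w j * z i) +
          ((1 - η * (l i + ρ * ‖y‖)) - (1 - η * (l j + ρ * ‖y‖))) * (w i * (z j + w j)) := by
        ring
      have h1 : 0 ≤ (1 - η * (l j + ρ * ‖y‖) + c) * (w i * z j - w j * z i) :=
        mul_nonneg (add_nonneg (hκ0 j) hc0) (sub_nonneg.2 hcr)
      have h2 := mul_nonneg (sub_nonneg.2 hκij) (mul_nonneg hi0.le (hzw j))
      linarith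
    refine ⟨?_, hcross⟩
    have hzi : 0 < z i + w i := add_pos_of_nonneg_of_pos (hz0 i) hi0
    exact pos_of_mul_pos_left (lt_of_lt_of_le (mul_pos hj hzi) hcross) (hzw j)
  refine ⟨hxy, ?_, hpat'⟩
  obtain ⟨k, hk1, hk2⟩ := exists_common_multiplier l w (a := ρ * ‖y‖) hη.le hl hβ0
    (fun i j hij hj => (hpat i j hij hj).1)
  have hyx_inner : ‖y‖ * (‖y‖ - ‖x‖) ≤ inner ℝ y (y - x) := by
    rw [inner_sub_right, real_inner_self_eq_norm_sq]
    nlinarith [real_inner_le_norm y x]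
  have hg : -(η * inner ℝ y (cubicGrad T b ρ y)) =
      ∑ i, η ^ 2 * inner ℝ (u i) b ^ 2 * (z i + w i) *
        ((1 - η * (l i + ρ * ‖y‖)) * w i - c * z i) := by
    rw [inner_eq_sum_coord u, Finset.mul_sum, ← Finset.sum_neg_distrib]
    refine Finset.sum_congr rfl fun i _ => ?_
    rw [← hw', coord_cubicGrad hT, hyc]
    ring
  have hlow : k * inner ℝ y (y - x) - c * inner ℝ y x ≤
      -(η * inner ℝ y (cubicGrad T b ρ y)) := by
    rw [hg, inner_eq_sum_coord u y, inner_eq_sum_coord u y, Finset.mul_sum, Finset.mul_sum,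
      ← Finset.sum_sub_distrib]
    refine Finset.sum_le_sum fun i _ => ?_
    have e : inner ℝ (u i) (y - x) = -(η * w i) * inner ℝ (u i) b := by
      rw [inner_sub_right (u i) y x, hyc, hzx]; ring
    rw [e, hyc, hzx]
    have h1 : 0 ≤ η ^ 2 * inner ℝ (u i) b ^ 2 * (z i + w i) :=
      mul_nonneg (by positivity) (hzw i)
    have h2 := mul_le_mul_of_nonneg_left (sub_le_sub_right (hk2 i) (c * z i)) h1
    nlinarith
  have hfin : 0 ≤ k * inner ℝ y (y - x) - c * inner ℝ y x := by
    have hk0 : 0 ≤ k - η * ρ * ‖x‖ := by linarith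
    have hkk : 0 ≤ k := by
      have : 0 ≤ η * ρ * ‖x‖ := by positivity
      linarith
    have h1 := mul_le_mul_of_nonneg_left hyx_inner hkk
    have h2 := mul_le_mul_of_nonneg_left (real_inner_le_norm y x) hc0
    have h3 : 0 ≤ (k - η * ρ * ‖x‖) * (‖y‖ * (‖y‖ - ‖x‖)) :=
      mul_nonneg hk0 (mul_nonneg (norm_nonneg _) (sub_nonneg.2 hxy))
    rw [hc] at h2 ⊢
    nlinarith
  by_contra hneg
  push Not at hneg
  nlinarith [mul_pos hη hneg]

/-- Gradient descent from a point on the ray `-ℝ₊ b` at which the gradient is not pointing outward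
has nondecreasing norms bounded by `B`, and its coordinates are nonpositive multiples of those
of `b`. -/
theorem gradientDescent_norm_mono {T : E →L[ℝ] E} {u : OrthonormalBasis ι ℝ E} {l : ι → ℝ}
    (hT : ∀ i x, inner ℝ (u i) (T x) = l i * inner ℝ (u i) x) {β : ℝ} (hβ : ‖T‖ ≤ β) {b : E}
    {ρ η B : ℝ} (hρ : 0 < ρ) (hη : 0 < η) (hB0 : 0 < B) (hB : β * B + ‖b‖ ≤ ρ * B ^ 2)
    (hηB : 3 * (η * (β + ρ * B)) ≤ 1) {x : ℕ → E} {a : ℝ} (ha : 0 ≤ a) (hx0 : x 0 = -(a • b))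
    (hx0' : inner ℝ (x 0) (cubicGrad T b ρ (x 0)) ≤ 0)
    (hstep : ∀ t, x (t + 1) = x t - η • cubicGrad T b ρ (x t)) (t : ℕ) :
    ‖x t‖ ≤ B ∧ ‖x t‖ ≤ ‖x (t + 1)‖ ∧
      ∀ i, ∃ z, 0 ≤ z ∧ inner ℝ (u i) (x t) = -z * inner ℝ (u i) b := by
  have key : ∀ t, inner ℝ (x t) (cubicGrad T b ρ (x t)) ≤ 0 ∧
      ∃ z, CoordPattern u l b ρ η (x t) z := by
    intro t
    induction t with
    | zero =>
      refine ⟨hx0', fun _ => a / η, fun _ => by positivity, fun i => ?_, fun i j hij hj => ?_⟩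
      · rw [hx0, inner_neg_right, real_inner_smul_right]; field_simp
      -- At the start all zᵢ equal a/η, so the ordering is just monotonicity in the eigenvalue.
      · have h1 : (1 - η * (l j + ρ * ‖x 0‖) * (a / η)) ≤ 1 - η * (l i + ρ * ‖x 0‖) * (a / η) := by
          gcongr
        exact ⟨hj.trans_le h1, mul_le_mul_of_nonneg_right h1 (by positivity)⟩
    | succ t ih =>
      obtain ⟨h1, z, hz⟩ := ih
      have h2 := coordPattern_step hT hβ hρ hη hB0 hB hηB hz h1
      simp only [← hstep] at h2
      exact ⟨h2.2.1, _, h2.2.2⟩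
  obtain ⟨h1, z, hz⟩ := key t
  have h2 := coordPattern_step hT hβ hρ hη hB0 hB hηB hz h1
  simp only [← hstep] at h2
  exact ⟨norm_le_of_inner_cubicGrad_nonpos hβ hρ hB0 hB h1, h2.1, fun i =>
    ⟨η * z i, mul_nonneg hη.le (hz.1 i), hz.2.1 i⟩⟩

end Eigenbasis

/-! ### Energy inequalities near a reference point and linear convergence. -/

section Descent

variable {E : Type*} [NormedAddCommGroup E] [InnerProductSpace ℝ E]

/-- A gradient descent sequence for `cubic T b ρ` with nondecreasing norms, staying in a ball on
which the step size `η` is small compared with the smoothness of the cubic. -/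
structure IsDescent (T : E →L[ℝ] E) (β : ℝ) (b : E) (ρ η B : ℝ) (x : ℕ → E) : Prop where
  symm : ∀ x y, inner ℝ (T x) y = inner ℝ x (T y)
  opNorm_le : ‖T‖ ≤ β
  rho_pos : 0 < ρ
  eta_pos : 0 < η
  small : 3 * (η * (β + ρ * B)) ≤ 1
  step : ∀ t, x (t + 1) = x t - η • cubicGrad T b ρ (x t)
  norm_le : ∀ t, ‖x t‖ ≤ B
  mono : Monotone fun t => ‖x t‖

theorem IsDescent.decrease {T : E →L[ℝ] E} {β : ℝ} {b : E} {ρ η B : ℝ} {x : ℕ → E}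
    (h : IsDescent T β b ρ η B x) (t : ℕ) :
    2 / 3 * η * ‖cubicGrad T b ρ (x t)‖ ^ 2 ≤ cubic T b ρ (x t) - cubic T b ρ (x (t + 1)) := by
  have h1 := h.norm_le (t + 1)
  rw [h.step] at h1 ⊢
  exact cubic_descent h.symm h.opNorm_le h.rho_pos h.eta_pos h.small (h.norm_le t) h1

theorem IsDescent.antitone {T : E →L[ℝ] E} {β : ℝ} {b : E} {ρ η B : ℝ} {x : ℕ → E}
    (h : IsDescent T β b ρ η B x) : Antitone fun t => cubic T b ρ (x t) := by
  refine antitone_nat_of_succ_le fun t => ?_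
  have h1 := h.decrease t
  have := h.eta_pos
  have h2 : 0 ≤ 2 / 3 * η * ‖cubicGrad T b ρ (x t)‖ ^ 2 := by positivity
  linarith

/-- The shifted quadratic form `⟨x - s, (T + ρ‖s‖)(x - s)⟩`. -/
noncomputable def shiftQuad (T : E →L[ℝ] E) (ρ : ℝ) (s x : E) : ℝ :=
  inner ℝ (x - s) (T (x - s)) + ρ * ‖s‖ * ‖x - s‖ ^ 2

/-- The nonnegative part of `⟨x - s, ∇f(x) - ∇f(s)⟩`. -/
noncomputable def gradGap (T : E →L[ℝ] E) (ρ : ℝ) (s x : E) : ℝ :=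
  shiftQuad T ρ s x + ρ / 2 * (‖x‖ - ‖s‖) ^ 2 * (‖x‖ + ‖s‖)
    + ρ / 2 * max (‖x‖ - ‖s‖) 0 * ‖x - s‖ ^ 2

theorem inner_cubicGrad_eq {T : E →L[ℝ] E} (b : E) (ρ : ℝ) (s x : E) :
    inner ℝ (x - s) (cubicGrad T b ρ x) = shiftQuad T ρ s x
      + ρ / 2 * (‖x‖ - ‖s‖) * ‖x - s‖ ^ 2 + ρ / 2 * (‖x‖ - ‖s‖) ^ 2 * (‖x‖ + ‖s‖)
      + inner ℝ (cubicGrad T b ρ s) (x - s) := by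
  have h1 : cubicGrad T b ρ x = cubicGrad T b ρ s + (T (x - s) + (ρ * ‖s‖) • (x - s)
      + (ρ * (‖x‖ - ‖s‖)) • x) := by
    simp only [cubicGrad, map_sub]
    module
  have h2 : inner ℝ (x - s) x = 1 / 2 * (‖x‖ ^ 2 - ‖s‖ ^ 2 + ‖x - s‖ ^ 2) := by
    rw [norm_sub_sq_real, inner_sub_left, real_inner_self_eq_norm_sq, real_inner_comm]
    ring
  rw [h1, inner_add_right, inner_add_right, inner_add_right, real_inner_smul_right,
    real_inner_smul_right, h2, real_inner_self_eq_norm_sq,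
    real_inner_comm (x - s) (cubicGrad T b ρ s), shiftQuad]
  ring

/-- This isolates the two terms that can be negative: the gradient at s, which is small, and a loss
present only while x is shorter than s. -/
theorem inner_cubicGrad_eq_gradGap {T : E →L[ℝ] E} (b : E) (ρ : ℝ) (s x : E) :
    inner ℝ (x - s) (cubicGrad T b ρ x) = gradGap T ρ s x
      + inner ℝ (cubicGrad T b ρ s) (x - s) - ρ / 2 * max (‖s‖ - ‖x‖) 0 * ‖x - s‖ ^ 2 := by
  rw [inner_cubicGrad_eq, gradGap]
  have : max (‖x‖ - ‖s‖) 0 - max (‖s‖ - ‖x‖) 0 = ‖x‖ - ‖s‖ := by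
    rcases le_total ‖x‖ ‖s‖ with h | h
    · rw [max_eq_right (by linarith), max_eq_left (by linarith)]; ring
    · rw [max_eq_left (by linarith), max_eq_right (by linarith)]; ring
  linear_combination (-ρ / 2 * ‖x - s‖ ^ 2) * this

theorem cubic_sub_eq {T : E →L[ℝ] E} (hT : ∀ x y, inner ℝ (T x) y = inner ℝ x (T y))
    (b : E) (ρ : ℝ) (s x : E) :
    cubic T b ρ x - cubic T b ρ s = inner ℝ (cubicGrad T b ρ s) (x - s)
      + 1 / 2 * shiftQuad T ρ s x + ρ / 6 * (‖x‖ - ‖s‖) ^ 2 * (‖s‖ + 2 * ‖x‖) := by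
  rw [cubic_expand hT b ρ s x, shiftQuad]
  ring

/-- The iterates do not leave the ball of radius `9/8 ‖s‖` when `s` is nearly critical and
`T + ρ‖s‖` is positive semidefinite. -/
theorem IsDescent.norm_le_of_nearly_critical {T : E →L[ℝ] E} {β : ℝ} {b : E} {ρ η B : ℝ}
    {x : ℕ → E} (h : IsDescent T β b ρ η B x) {s : E} (hs0 : s ≠ 0)
    (hpsd : ∀ x, 0 ≤ inner ℝ x (T x) + ρ * ‖s‖ * ‖x‖ ^ 2) {σ : ℝ}
    (hσ : ‖cubicGrad T b ρ s‖ ≤ σ) (hσs : 24 * σ ≤ ρ * ‖s‖ ^ 2) (t : ℕ) :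
    ‖x t‖ ≤ 9 / 8 * ‖s‖ := by
  by_contra hlt
  push Not at hlt
  have hρ := h.rho_pos
  have hη := h.eta_pos
  have hn : 0 < ‖s‖ := norm_pos_iff.2 hs0
  -- Norms are monotone, so all later iterates stay outside the ball too. There positivity of T +
  -- ρ‖s‖ forces ρ‖s‖²/16 ≤ σ + ‖∇f‖, and 1/16 - 1/24 = 1/48; the values would then decrease without
  -- bound.
  have hgrad : ∀ k, ρ * ‖s‖ ^ 2 / 48 ≤ ‖cubicGrad T b ρ (x (t + k))‖ := by
    intro k
    have hN : 9 / 8 * ‖s‖ ≤ ‖x (t + k)‖ := hlt.le.trans (h.mono (Nat.le_add_right t k))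
    generalize x (t + k) = y at hN
    have hw : 0 < ‖y - s‖ := by
      have := norm_sub_norm_le y s
      linarith
    have h1 := inner_cubicGrad_eq (T := T) b ρ s y
    have h2 := hpsd (y - s)
    have h3 := (abs_le.1 (abs_real_inner_le_norm (cubicGrad T b ρ s) (y - s))).1
    have h4 := real_inner_le_norm (y - s) (cubicGrad T b ρ y)
    have h5 : ‖cubicGrad T b ρ s‖ * ‖y - s‖ ≤ σ * ‖y - s‖ := by gcongr
    rw [shiftQuad] at h1
    have h6 : (‖s‖ / 8) * (‖s‖ ^ 2 / 4) ≤ (‖y‖ - ‖s‖) ^ 2 * (‖y‖ + ‖s‖) := by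
      have a1 : ‖s‖ / 8 ≤ ‖y‖ - ‖s‖ := by linarith
      have a2 : 2 * ‖s‖ ≤ ‖y‖ + ‖s‖ := by linarith
      have a3 : (‖s‖ / 8) ^ 2 ≤ (‖y‖ - ‖s‖) ^ 2 := by gcongr
      have a4 : (‖s‖ / 8) ^ 2 * (17 / 8 * ‖s‖) ≤ (‖y‖ - ‖s‖) ^ 2 * (‖y‖ + ‖s‖) := by
        gcongr
        linarith
      nlinarith [pow_pos hn 3]
    have h7 : ‖s‖ / 8 * ‖y - s‖ ^ 2 ≤ (‖y‖ - ‖s‖) * ‖y - s‖ ^ 2 := by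
      gcongr; linarith
    have h8 : ‖s‖ * ‖y - s‖ ≤ ‖s‖ ^ 2 / 4 + ‖y - s‖ ^ 2 := by
      nlinarith [sq_nonneg (‖s‖ / 2 - ‖y - s‖)]
    have h9 : ‖s‖ / 8 * (‖s‖ * ‖y - s‖) ≤ ‖s‖ / 8 * (‖s‖ ^ 2 / 4 + ‖y - s‖ ^ 2) := by gcongr
    have h10 : ρ / 2 * (‖s‖ / 8 * (‖s‖ * ‖y - s‖)) ≤
        ρ / 2 * ((‖y‖ - ‖s‖) * ‖y - s‖ ^ 2 + (‖y‖ - ‖s‖) ^ 2 * (‖y‖ + ‖s‖)) := by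
      gcongr; linarith
    have h11 : (ρ * ‖s‖ ^ 2 / 16) * ‖y - s‖ ≤ (σ + ‖cubicGrad T b ρ y‖) * ‖y - s‖ := by
      nlinarith
    have h12 := le_of_mul_le_mul_right h11 hw
    linarith
  set c := 2 / 3 * η * (ρ * ‖s‖ ^ 2 / 48) ^ 2 with hc
  have hc0 : 0 < c := by positivity
  have hdec : ∀ k : ℕ, cubic T b ρ (x (t + k)) ≤ cubic T b ρ (x t) - k * c := by
    intro k
    induction k with
    | zero => simp
    | succ k ih =>
      have h1 := h.decrease (t + k)
      have h2 : c ≤ 2 / 3 * η * ‖cubicGrad T b ρ (x (t + k))‖ ^ 2 := by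
        rw [hc]; gcongr; exact hgrad k
      rw [← add_assoc]
      push_cast
      linarith
  have hlow : ∀ k, -(1 / 2 * β * B ^ 2 + ‖b‖ * B) ≤ cubic T b ρ (x k) := by
    intro k
    have h1 := (abs_le.1 (abs_inner_apply_le h.opNorm_le (x k))).1
    have h2 := (abs_le.1 (abs_real_inner_le_norm b (x k))).1
    have h3 : β * ‖x k‖ ^ 2 ≤ β * B ^ 2 := by
      have := (norm_nonneg T).trans h.opNorm_le
      have := h.norm_le k
      gcongr
    have h4 : ‖b‖ * ‖x k‖ ≤ ‖b‖ * B := by gcongr; exact h.norm_le k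
    have h5 : 0 ≤ ρ / 3 * ‖x k‖ ^ 3 := by positivity
    rw [cubic]
    linarith
  obtain ⟨k, hk⟩ := exists_nat_gt ((cubic T b ρ (x t) + (1 / 2 * β * B ^ 2 + ‖b‖ * B)) / c)
  rw [div_lt_iff₀ hc0] at hk
  linarith [hdec k, hlow (t + k)]

/-- Bounds at a point in the ball of radius `9/8 ‖s‖` and in the halfspace of `s`. -/
structure IsNear (T : E →L[ℝ] E) (b : E) (ρ ε : ℝ) (s x : E) : Prop where
  psd : ∀ x, 0 ≤ inner ℝ x (T x) + ρ * ‖s‖ * ‖x‖ ^ 2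
  grad_le : 24 * ‖cubicGrad T b ρ s‖ * ‖s‖ ≤ ε
  norm_le : ‖x‖ ≤ 9 / 8 * ‖s‖
  inner_nonneg : 0 ≤ inner ℝ x s

section Near

variable {T : E →L[ℝ] E} {b : E} {ρ ε : ℝ} {s x : E}

theorem IsNear.dist_sq_le (h : IsNear T b ρ ε s x) : ‖x - s‖ ^ 2 ≤ 145 / 64 * ‖s‖ ^ 2 := by
  rw [norm_sub_sq_real]
  have h1 : ‖x‖ ^ 2 ≤ (9 / 8 * ‖s‖) ^ 2 := by gcongr; exact h.norm_le
  nlinarith [h.inner_nonneg]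

theorem IsNear.abs_inner_grad_le (h : IsNear T b ρ ε s x) :
    |inner ℝ (cubicGrad T b ρ s) (x - s)| ≤ ε / 15 := by
  refine (abs_real_inner_le_norm _ _).trans ?_
  have hε : 0 ≤ ε := le_trans (by positivity) h.grad_le
  refine abs_le_of_sq_le_sq' ?_ (by positivity) |>.2
  rw [mul_pow]
  have h1 : (24 * ‖cubicGrad T b ρ s‖ * ‖s‖) ^ 2 ≤ ε ^ 2 := by gcongr; exact h.grad_le
  have h2 : ‖cubicGrad T b ρ s‖ ^ 2 * ‖x - s‖ ^ 2 ≤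
      ‖cubicGrad T b ρ s‖ ^ 2 * (145 / 64 * ‖s‖ ^ 2) := by gcongr; exact h.dist_sq_le
  nlinarith

theorem IsNear.shiftQuad_nonneg (h : IsNear T b ρ ε s x) : 0 ≤ shiftQuad T ρ s x :=
  h.psd (x - s)

theorem IsNear.shiftQuad_le_gradGap (hρ : 0 < ρ) : shiftQuad T ρ s x ≤ gradGap T ρ s x := by
  rw [gradGap]
  have h1 : 0 ≤ ρ / 2 * (‖x‖ - ‖s‖) ^ 2 * (‖x‖ + ‖s‖) := by positivity
  have h2 : 0 ≤ ρ / 2 * max (‖x‖ - ‖s‖) 0 * ‖x - s‖ ^ 2 := by positivity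
  linarith

theorem IsNear.cubic_sub_le_gradGap (h : IsNear T b ρ ε s x) (hρ : 0 < ρ)
    (hT : ∀ x y, inner ℝ (T x) y = inner ℝ x (T y)) :
    cubic T b ρ x - cubic T b ρ s ≤ 5 / 9 * gradGap T ρ s x + ε / 15 := by
  rw [cubic_sub_eq hT, gradGap]
  have h1 := (abs_le.1 h.abs_inner_grad_le).2
  have h2 := h.shiftQuad_nonneg
  have h3 : 0 ≤ ρ / 2 * max (‖x‖ - ‖s‖) 0 * ‖x - s‖ ^ 2 := by positivity
  have h4 : ρ / 6 * (‖x‖ - ‖s‖) ^ 2 * (‖s‖ + 2 * ‖x‖) ≤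
      ρ / 6 * (‖x‖ - ‖s‖) ^ 2 * (5 / 3 * (‖x‖ + ‖s‖)) := by
    refine mul_le_mul_of_nonneg_left ?_ (by positivity)
    linarith [h.norm_le, norm_nonneg s]
  nlinarith

theorem IsNear.cubic_sub_le_dist (h : IsNear T b ρ ε s x) (hρ : 0 < ρ)
    (hT : ∀ x y, inner ℝ (T x) y = inner ℝ x (T y)) {β : ℝ} (hβ : ‖T‖ ≤ β) :
    cubic T b ρ x - cubic T b ρ s ≤
      25 / 48 * (β + 2 * ρ * ‖s‖) * ‖x - s‖ ^ 2 + ε / 15 := by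
  rw [cubic_sub_eq hT, shiftQuad]
  have h1 := (abs_le.1 h.abs_inner_grad_le).2
  have h2 := (abs_le.1 (abs_inner_apply_le hβ (x - s))).2
  have h3 : (‖x‖ - ‖s‖) ^ 2 ≤ ‖x - s‖ ^ 2 := by
    have := abs_norm_sub_norm_le x s
    exact sq_le_sq' (by linarith [neg_abs_le (‖x‖ - ‖s‖), norm_nonneg (x - s)])
      (by linarith [le_abs_self (‖x‖ - ‖s‖)])
  have h4 : ρ / 6 * (‖x‖ - ‖s‖) ^ 2 * (‖s‖ + 2 * ‖x‖) ≤
      ρ / 6 * ‖x - s‖ ^ 2 * (13 / 4 * ‖s‖) :=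
    mul_le_mul (by gcongr) (by linarith [h.norm_le]) (by positivity) (by positivity)
  have h5 : 0 ≤ β * ‖x - s‖ ^ 2 :=
    mul_nonneg ((norm_nonneg T).trans hβ) (sq_nonneg _)
  nlinarith

/-- Before accuracy ε is reached, the gradient gap dominates ε, so errors of order ε can be absorbed
into it; 42/25 = (14/15)(9/5). -/
theorem IsNear.le_gradGap (h : IsNear T b ρ ε s x) (hρ : 0 < ρ)
    (hT : ∀ x y, inner ℝ (T x) y = inner ℝ x (T y))
    (hF : ε < cubic T b ρ x - cubic T b ρ s) : 42 / 25 * ε ≤ gradGap T ρ s x := by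
  linarith [h.cubic_sub_le_gradGap hρ hT]

theorem IsNear.le_inner_cubicGrad (h : IsNear T b ρ ε s x) (hρ : 0 < ρ)
    (hT : ∀ x y, inner ℝ (T x) y = inner ℝ x (T y))
    (hF : ε < cubic T b ρ x - cubic T b ρ s) :
    24 / 25 * gradGap T ρ s x - ρ / 2 * max (‖s‖ - ‖x‖) 0 * ‖x - s‖ ^ 2 ≤
      inner ℝ (x - s) (cubicGrad T b ρ x) := by
  rw [inner_cubicGrad_eq_gradGap]
  have hε : 0 ≤ ε := le_trans (by positivity) h.grad_le
  linarith [h.le_gradGap hρ hT hF, (abs_le.1 h.abs_inner_grad_le).1]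

end Near

/-- Linear convergence as long as the accuracy `ε` is not reached. -/
theorem IsDescent.exp_le {T : E →L[ℝ] E} {β : ℝ} {b : E} {ρ η B : ℝ} {x : ℕ → E}
    (h : IsDescent T β b ρ η B x) {s : E} {ε μ : ℝ} (hμ : 0 < μ) (hε : 0 < ε)
    (hη : 4 * (η * (β + ρ * ‖s‖)) ≤ 1) {t k : ℕ}
    (hnear : ∀ j, t ≤ j → j ≤ t + k → IsNear T b ρ ε s (x j))
    (hF : ∀ j, t ≤ j → j ≤ t + k → ε < cubic T b ρ (x j) - cubic T b ρ s)
    (hG : ∀ j, t ≤ j → j < t + k → μ * (‖x j - s‖ ^ 2 + 9 / 10 * η * gradGap T ρ s (x j)) ≤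
      5 * inner ℝ (x j - s) (cubicGrad T b ρ (x j))) :
    Real.exp (2 / 5 * (η * μ) * k) ≤ 2 * ((β + 2 * ρ * ‖s‖) * ‖s‖ ^ 2 / ε) := by
  have hρ := h.rho_pos
  have hη0 := h.eta_pos
  have hβ0 := (norm_nonneg T).trans h.opNorm_le
  -- The weight 3η/2 makes the decrease of the values, at least (2/3)η‖∇f‖², cancel the term η²‖∇f‖²
  -- in the expansion of the squared distance.
  set V : ℕ → ℝ := fun j => ‖x j - s‖ ^ 2 + 3 / 2 * η * (cubic T b ρ (x j) - cubic T b ρ s)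
    with hV
  have hVstep : ∀ j, t ≤ j → j < t + k → V (j + 1) ≤ Real.exp (-(2 / 5 * (η * μ))) * V j := by
    intro j hj hjk
    have hn := hnear j hj hjk.le
    have h1 := hG j hj hjk
    have h2 := h.decrease j
    have h3 := hF j hj hjk.le
    have h4 := hn.le_gradGap hρ h.symm h3
    have h5 := hn.cubic_sub_le_gradGap hρ h.symm
    have h6 : ‖x (j + 1) - s‖ ^ 2 = ‖x j - s‖ ^ 2
        - 2 * (η * inner ℝ (x j - s) (cubicGrad T b ρ (x j)))
        + η ^ 2 * ‖cubicGrad T b ρ (x j)‖ ^ 2 := by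
      rw [h.step, sub_right_comm, norm_sub_sq_real, real_inner_smul_right, norm_smul, mul_pow,
        Real.norm_eq_abs, sq_abs]
    have h7 : V j ≤ ‖x j - s‖ ^ 2 + 9 / 10 * η * gradGap T ρ s (x j) := by
      have : 3 / 2 * η * (cubic T b ρ (x j) - cubic T b ρ s) ≤
          3 / 2 * η * (3 / 5 * gradGap T ρ s (x j)) := by gcongr; linarith
      simp only [hV]
      linarith
    have hV0 : 0 ≤ V j := by
      have : 0 ≤ cubic T b ρ (x j) - cubic T b ρ s := by linarith
      positivity
    have h8 : V (j + 1) ≤ V j - 2 * (η * inner ℝ (x j - s) (cubicGrad T b ρ (x j))) := by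
      simp only [hV]
      rw [h6]
      have := mul_le_mul_of_nonneg_left h2 (by positivity : 0 ≤ 3 / 2 * η)
      nlinarith
    have h9 : η * (μ * V j) ≤ η * (5 * inner ℝ (x j - s) (cubicGrad T b ρ (x j))) :=
      mul_le_mul_of_nonneg_left ((mul_le_mul_of_nonneg_left h7 hμ.le).trans h1) hη0.le
    have h10 : (1 - 2 / 5 * (η * μ)) * V j ≤ Real.exp (-(2 / 5 * (η * μ))) * V j := by
      gcongr
      linarith [Real.add_one_le_exp (-(2 / 5 * (η * μ)))]
    nlinarith
  have hViter : ∀ i, i ≤ k → V (t + i) ≤ Real.exp (-(2 / 5 * (η * μ))) ^ i * V t := by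
    intro i
    induction i with
    | zero => simp
    | succ i ih =>
      intro hi
      have h1 := hVstep (t + i) (Nat.le_add_right _ _) (by omega)
      have h2 := ih (by omega)
      rw [pow_succ, mul_comm (_ ^ i), mul_assoc, ← add_assoc]
      exact h1.trans (by gcongr)
  have hVk := hViter k le_rfl
  have hlow : 14 / 15 * ε ≤ 25 / 48 * (β + 2 * ρ * ‖s‖) * V (t + k) := by
    have h1 := (hnear (t + k) (Nat.le_add_right _ _) le_rfl).cubic_sub_le_dist hρ h.symm
      h.opNorm_le
    have h2 := hF (t + k) (Nat.le_add_right _ _) le_rfl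
    have h3 : ‖x (t + k) - s‖ ^ 2 ≤ V (t + k) := by
      have : 0 ≤ 3 / 2 * η * (cubic T b ρ (x (t + k)) - cubic T b ρ s) :=
        mul_nonneg (by positivity) (by linarith)
      simp only [hV]; linarith
    have h4 : 25 / 48 * (β + 2 * ρ * ‖s‖) * ‖x (t + k) - s‖ ^ 2 ≤
        25 / 48 * (β + 2 * ρ * ‖s‖) * V (t + k) := by gcongr
    linarith
  have hup : V t ≤ 143 / 100 * (145 / 64 * ‖s‖ ^ 2) := by
    have hn := hnear t le_rfl (Nat.le_add_right _ _)
    have h1 := hn.cubic_sub_le_dist hρ h.symm h.opNorm_le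
    have h2 := hF t le_rfl (Nat.le_add_right _ _)
    have h3 : cubic T b ρ (x t) - cubic T b ρ s ≤
        15 / 14 * (25 / 48 * (β + 2 * ρ * ‖s‖) * ‖x t - s‖ ^ 2) := by linarith
    have h4 : η * (cubic T b ρ (x t) - cubic T b ρ s) ≤
        η * (15 / 14 * (25 / 48 * (β + 2 * ρ * ‖s‖) * ‖x t - s‖ ^ 2)) := by gcongr
    have h5 : η * (β + 2 * ρ * ‖s‖) ≤ 1 / 2 := by nlinarith [mul_nonneg hη0.le hβ0]
    have h6 : η * (β + 2 * ρ * ‖s‖) * ‖x t - s‖ ^ 2 ≤ 1 / 2 * ‖x t - s‖ ^ 2 := by gcongr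
    have h7 := hn.dist_sq_le
    simp only [hV]
    nlinarith
  have hL : 0 ≤ β + 2 * ρ * ‖s‖ := by positivity
  have hexp : Real.exp (2 / 5 * (η * μ) * k) * Real.exp (-(2 / 5 * (η * μ))) ^ k = 1 := by
    rw [← Real.exp_nat_mul, ← Real.exp_add]
    simp only [Real.exp_eq_one_iff]
    ring
  rw [← mul_div_assoc, le_div_iff₀ hε]
  set X := Real.exp (2 / 5 * (η * μ) * k)
  have hX : 0 < X := Real.exp_pos _
  have h1 : X * V (t + k) ≤ V t := by
    calc X * V (t + k) ≤ X * (Real.exp (-(2 / 5 * (η * μ))) ^ k * V t) := by gcongr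
      _ = V t := by rw [← mul_assoc, hexp, one_mul]
  have h2 : X * (14 / 15 * ε) ≤ X * (25 / 48 * (β + 2 * ρ * ‖s‖) * V (t + k)) := by gcongr
  have h3 : 25 / 48 * (β + 2 * ρ * ‖s‖) * (X * V (t + k)) ≤
      25 / 48 * (β + 2 * ρ * ‖s‖) * (143 / 100 * (145 / 64 * ‖s‖ ^ 2)) :=
    mul_le_mul_of_nonneg_left (h1.trans hup) (by positivity)
  have h4 : 0 ≤ (β + 2 * ρ * ‖s‖) * ‖s‖ ^ 2 := by positivity
  nlinarith

end Descent

/-! ### Growth and contraction along individual eigenvectors. -/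

section Coordinates

variable {E ι : Type*} [NormedAddCommGroup E] [InnerProductSpace ℝ E] [Fintype ι]
  {T : E →L[ℝ] E} {u : OrthonormalBasis ι ℝ E} {l : ι → ℝ} {β : ℝ} {b : E} {ρ η B : ℝ} {x : ℕ → E}

/-- Geometric growth along an eigenvector of a negative eigenvalue `-γ`, as long as
`ρ‖x t‖ < γ - δ`. -/
theorem IsDescent.growth (h : IsDescent T β b ρ η B x)
    (hT : ∀ i x, inner ℝ (u i) (T x) = l i * inner ℝ (u i) x) {i : ι} {γ δ θ : ℝ}
    (hi : l i = -γ) (hδ : 0 < δ) (hηγ : 4 * (η * γ) ≤ 1) (hθ : 0 < θ)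
    (hθb : θ ≤ |inner ℝ (u i) b|)
    (hsign : ∀ t, inner ℝ (u i) (x t) * inner ℝ (u i) b ≤ 0) {t : ℕ}
    (ht : Real.log (1 + γ ^ 2 / (4 * ρ * θ)) ≤ 4 / 5 * (η * δ) * t) :
    γ - δ ≤ ρ * ‖x t‖ := by
  by_contra hlt
  push Not at hlt
  have hρ := h.rho_pos
  have hη := h.eta_pos
  set c := inner ℝ (u i) b with hc
  have hc0 : 0 < |c| := hθ.trans_le hθb
  -- Since the coordinate and -c have the same sign, both terms of the recursion add up in absolute
  -- value; the induction starts from the trivial bound 0.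
  have hind : ∀ j, j ≤ t → θ * ((1 + η * δ) ^ j - 1) ≤ δ * |inner ℝ (u i) (x j)| := by
    intro j
    induction j with
    | zero => intro _; simp; positivity
    | succ j ih =>
      intro hj
      have ih := ih (by omega)
      have hN : ρ * ‖x j‖ ≤ ρ * ‖x t‖ := by gcongr; exact h.mono (by omega)
      have hstep : inner ℝ (u i) (x (j + 1)) =
          (1 + η * (γ - ρ * ‖x j‖)) * inner ℝ (u i) (x j) - η * c := by
        rw [h.step, inner_sub_right, real_inner_smul_right, coord_cubicGrad hT, hi]
        ring
      set y := inner ℝ (u i) (x j)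
      have hyc : y * c = -(|y| * |c|) := by
        rw [← abs_mul, abs_of_nonpos (hsign j), neg_neg]
      have h1 : (1 + η * δ) * |y| + η * |c| ≤ |inner ℝ (u i) (x (j + 1))| := by
        refine le_of_mul_le_mul_right ?_ hc0
        rw [← abs_mul, hstep]
        refine le_trans ?_ (neg_le_abs _)
        have h2 : (1 + η * δ) * (|y| * |c|) ≤ (1 + η * (γ - ρ * ‖x j‖)) * (|y| * |c|) := by
          gcongr; linarith
        have h3 : |c| * |c| = c * c := abs_mul_abs_self c
        linear_combination h2 + (1 + η * (γ - ρ * ‖x j‖)) * hyc + η * h3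
      have h4 : δ * ((1 + η * δ) * |y| + η * |c|) ≤ δ * |inner ℝ (u i) (x (j + 1))| := by gcongr
      have h5 : (1 + η * δ) * (θ * ((1 + η * δ) ^ j - 1)) ≤ (1 + η * δ) * (δ * |y|) := by
        gcongr
      have h6 : η * δ * θ ≤ η * δ * |c| := by gcongr
      rw [pow_succ]
      linarith
  have h1 := hind t le_rfl
  have h2 : δ * |inner ℝ (u i) (x t)| ≤ δ * ‖x t‖ := by gcongr; exact abs_coord_le u i (x t)
  -- From δ(γ - δ) ≤ γ²/4.
  have h3 : δ * ‖x t‖ < γ ^ 2 / (4 * ρ) := by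
    rw [lt_div_iff₀ (by positivity)]
    nlinarith [sq_nonneg (γ - 2 * δ), mul_lt_mul_of_pos_left hlt hδ]
  have h4 : (1 + η * δ) ^ t < 1 + γ ^ 2 / (4 * ρ * θ) := by
    have : γ ^ 2 / (4 * ρ * θ) * θ = γ ^ 2 / (4 * ρ) := by field_simp
    by_contra hge
    push Not at hge
    have : θ * (γ ^ 2 / (4 * ρ * θ)) ≤ θ * ((1 + η * δ) ^ t - 1) := by gcongr; linarith
    linarith
  have hηδ : η * δ ≤ 1 / 4 := by
    have : 0 ≤ ρ * ‖x t‖ := by positivity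
    have : η * δ ≤ η * γ := by gcongr; linarith
    linarith
  have hηδ0 : 0 < η * δ := mul_pos hη hδ
  have h5 : 4 / 5 * (η * δ) ≤ Real.log (1 + η * δ) := by
    have h6 := Real.one_sub_inv_le_log_of_pos (by positivity : 0 < 1 + η * δ)
    have h7 : 4 / 5 * (η * δ) ≤ 1 - (1 + η * δ)⁻¹ := by
      have : 1 - (1 + η * δ)⁻¹ = η * δ / (1 + η * δ) := by field_simp; ring
      rw [this, le_div_iff₀ (by positivity)]
      nlinarith
    linarith
  have h6 := Real.log_lt_log (by positivity) h4
  rw [Real.log_pow] at h6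
  have h7 : 4 / 5 * (η * δ) * t ≤ t * Real.log (1 + η * δ) := by
    rw [mul_comm]; gcongr
  linarith

/-- A recursion for the coordinates of `x t - s`. -/
theorem IsDescent.coord_sub_step (h : IsDescent T β b ρ η B x)
    (hT : ∀ i x, inner ℝ (u i) (T x) = l i * inner ℝ (u i) x) (s : E) (i : ι) (t : ℕ) :
    inner ℝ (u i) (x (t + 1) - s) =
      (1 - η * (l i + ρ * ‖x t‖)) * inner ℝ (u i) (x t - s)
        + η * (ρ * (‖s‖ - ‖x t‖) * inner ℝ (u i) s - inner ℝ (u i) (cubicGrad T b ρ s)) := by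
  rw [h.step, inner_sub_right, inner_sub_right, inner_sub_right, real_inner_smul_right,
    coord_cubicGrad hT, coord_cubicGrad hT]
  ring

/-- While `|ρ(‖x‖ - ‖s‖)| ≤ μ`, a coordinate of `x - s` at an eigenvalue `a = l i + ρ‖s‖ ≥ 4μ`
contracts at rate `3ημ` up to an error of size `μ/a`. -/
theorem IsDescent.abs_coord_sub_le (h : IsDescent T β b ρ η B x)
    (hT : ∀ i x, inner ℝ (u i) (T x) = l i * inner ℝ (u i) x) {s : E} {μ : ℝ} (hμ : 0 < μ)
    (hη : 4 * (η * (β + ρ * ‖s‖)) ≤ 1) {i : ι} (ha : 4 * μ ≤ l i + ρ * ‖s‖) (t k : ℕ)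
    (hh : ∀ j, t ≤ j → j < t + k → ρ * (‖x j‖ - ‖s‖) ≤ μ ∧ ρ * (‖s‖ - ‖x j‖) ≤ 13 / 20 * μ) :
    |inner ℝ (u i) (x (t + k) - s)| ≤ Real.exp (-(3 * (η * μ))) ^ k * |inner ℝ (u i) (x t - s)|
      + (μ * |inner ℝ (u i) s| + |inner ℝ (u i) (cubicGrad T b ρ s)|)
        / (4 / 5 * (l i + ρ * ‖s‖)) := by
  have hρ := h.rho_pos
  have hη0 := h.eta_pos
  set a := l i + ρ * ‖s‖ with ha'
  have ha0 : 0 < a := by linarith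
  have haβ : 4 * (η * a) ≤ 1 := by
    have : η * a ≤ η * (β + ρ * ‖s‖) := by
      gcongr
      rw [ha']
      linarith [(abs_le.1 (abs_eigenvalue_le hT h.opNorm_le i)).2]
    linarith
  set f := μ * |inner ℝ (u i) s| + |inner ℝ (u i) (cubicGrad T b ρ s)| with hf
  have hf0 : 0 ≤ f := by positivity
  induction k with
  | zero =>
    simp only [add_zero, pow_zero, one_mul]
    have : 0 ≤ f / (4 / 5 * a) := by positivity
    linarith
  | succ k ih =>
    have ih := ih fun j h1 h2 => hh j h1 (by omega)
    obtain ⟨h1, h2⟩ := hh (t + k) (Nat.le_add_right _ _) (by omega)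
    rw [← add_assoc, h.coord_sub_step hT]
    set y := inner ℝ (u i) (x (t + k) - s)
    -- The norm deficit costs at most 13μ/20 ≤ a/5, because a ≥ 4μ.
    have hlow : 4 / 5 * a ≤ l i + ρ * ‖x (t + k)‖ := by linarith
    have hupp : η * (l i + ρ * ‖x (t + k)‖) ≤ 1 := by
      have : η * (l i + ρ * ‖x (t + k)‖) ≤ η * (2 * a) := by gcongr; linarith
      linarith
    have h3 : |(1 - η * (l i + ρ * ‖x (t + k)‖)) * y| ≤ (1 - 4 / 5 * (η * a)) * |y| := by
      rw [abs_mul, abs_of_nonneg (by linarith)]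
      refine mul_le_mul_of_nonneg_right ?_ (abs_nonneg _)
      nlinarith [mul_le_mul_of_nonneg_left hlow hη0.le]
    have h4 : |η * (ρ * (‖s‖ - ‖x (t + k)‖) * inner ℝ (u i) s
        - inner ℝ (u i) (cubicGrad T b ρ s))| ≤ η * f := by
      rw [abs_mul, abs_of_pos hη0, hf]
      gcongr
      refine (abs_sub _ _).trans ?_
      rw [abs_mul]
      gcongr
      rw [abs_le]
      constructor <;> linarith
    have h5 : (1 - 4 / 5 * (η * a)) * |y| ≤ (1 - 4 / 5 * (η * a)) *
        (Real.exp (-(3 * (η * μ))) ^ k * |inner ℝ (u i) (x t - s)| + f / (4 / 5 * a)) := by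
      gcongr
      linarith
    -- The error term is the fixed point of e ↦ (1 - 4ηa/5)e + ηf, so errors do not accumulate.
    have h6 : (1 - 4 / 5 * (η * a)) * (f / (4 / 5 * a)) + η * f = f / (4 / 5 * a) := by
      field_simp
      ring
    have h7 : (1 - 4 / 5 * (η * a)) * (Real.exp (-(3 * (η * μ))) ^ k * |inner ℝ (u i) (x t - s)|)
        ≤ Real.exp (-(3 * (η * μ))) *
          (Real.exp (-(3 * (η * μ))) ^ k * |inner ℝ (u i) (x t - s)|) := by
      gcongr
      have : 3 * (η * μ) ≤ 4 / 5 * (η * a) := by nlinarith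
      linarith [Real.add_one_le_exp (-(3 * (η * μ)))]
    have h8 := abs_add_le ((1 - η * (l i + ρ * ‖x (t + k)‖)) * y)
      (η * (ρ * (‖s‖ - ‖x (t + k)‖) * inner ℝ (u i) s - inner ℝ (u i) (cubicGrad T b ρ s)))
    rw [pow_succ']
    linarith

/-- Coordinatewise bounds give a bound for the shifted quadratic form. -/
theorem shiftQuad_le_of_coord (hT : ∀ i x, inner ℝ (u i) (T x) = l i * inner ℝ (u i) x)
    {s y z w e : E} {c₁ c₂ c₃ c₄ : ℝ}
    (h : ∀ i, (l i + ρ * ‖s‖) * inner ℝ (u i) (y - s) ^ 2 ≤ c₁ * inner ℝ (u i) (y - s) ^ 2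
      + c₂ * inner ℝ (u i) z ^ 2 + c₃ * (c₄ * inner ℝ (u i) w ^ 2 + inner ℝ (u i) e ^ 2)) :
    shiftQuad T ρ s y ≤ c₁ * ‖y - s‖ ^ 2 + c₂ * ‖z‖ ^ 2 + c₃ * (c₄ * ‖w‖ ^ 2 + ‖e‖ ^ 2) := by
  have h1 := Finset.sum_le_sum fun i (_ : i ∈ Finset.univ) => h i
  simp only [add_mul, Finset.sum_add_distrib, ← Finset.mul_sum, ← norm_sq_eq_sum_coord,
    ← inner_apply_eq_sum hT] at h1
  exact h1

/-- A coordinate of `x - s` either belongs to the lowest eigenvalue `m` of `T + ρ‖s‖` or is small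
after `k` steps with `|ρ(‖x‖ - ‖s‖)| ≤ μ`. -/
theorem IsDescent.coord_sq_le_of_gap (h : IsDescent T β b ρ η B x)
    (hT : ∀ i x, inner ℝ (u i) (T x) = l i * inner ℝ (u i) x) {s : E} {μ g m : ℝ}
    (hμ : 0 < μ) (hη : 4 * (η * (β + ρ * ‖s‖)) ≤ 1) (hg0 : 0 < g) (h4μ : 4 * μ ≤ g) (hm : 0 ≤ m)
    (hgap : ∀ i, l i + ρ * ‖s‖ = m ∨ g ≤ l i + ρ * ‖s‖) (t k : ℕ)
    (hh : ∀ j, t ≤ j → j < t + k → ρ * (‖x j‖ - ‖s‖) ≤ μ ∧ ρ * (‖s‖ - ‖x j‖) ≤ 13 / 20 * μ)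
    (i : ι) :
    (l i + ρ * ‖s‖) * inner ℝ (u i) (x (t + k) - s) ^ 2 ≤
      m * inner ℝ (u i) (x (t + k) - s) ^ 2
        + 2 * (β + 2 * ρ * ‖s‖) * (Real.exp (-(3 * (η * μ))) ^ k) ^ 2
          * inner ℝ (u i) (x t - s) ^ 2
        + 25 / 4 / g * (μ ^ 2 * inner ℝ (u i) s ^ 2
          + inner ℝ (u i) (cubicGrad T b ρ s) ^ 2) := by
  have hρ := h.rho_pos
  have hβ0 := (norm_nonneg T).trans h.opNorm_le
  have hL0 : 0 ≤ β + 2 * ρ * ‖s‖ := by positivity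
  have h0 := fun hi => h.abs_coord_sub_le hT hμ hη (i := i) hi t k hh
  set q := Real.exp (-(3 * (η * μ))) ^ k
  have haL : l i + ρ * ‖s‖ ≤ β + 2 * ρ * ‖s‖ := by
    have := (abs_le.1 (abs_eigenvalue_le hT h.opNorm_le i)).2
    nlinarith [mul_nonneg hρ.le (norm_nonneg s)]
  set L := β + 2 * ρ * ‖s‖
  have hgi := hgap i
  set a := l i + ρ * ‖s‖
  rw [← sq_abs (inner ℝ (u i) (x (t + k) - s)), ← sq_abs (inner ℝ (u i) (x t - s)),
    ← sq_abs (inner ℝ (u i) s), ← sq_abs (inner ℝ (u i) (cubicGrad T b ρ s))]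
  generalize |inner ℝ (u i) s| = p at *
  generalize |inner ℝ (u i) (cubicGrad T b ρ s)| = r at *
  generalize |inner ℝ (u i) (x t - s)| = w at *
  have hy0 := abs_nonneg (inner ℝ (u i) (x (t + k) - s))
  generalize |inner ℝ (u i) (x (t + k) - s)| = y at *
  have n1 : 0 ≤ 2 * L * q ^ 2 * w ^ 2 := by positivity
  rcases hgi with hi | hi
  · rw [hi]
    have h2 : 0 ≤ 25 / 4 / g * (μ ^ 2 * p ^ 2 + r ^ 2) := by positivity
    linarith
  · have h1 := h0 (h4μ.trans hi)
    have ha0 : 0 < a := by linarith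
    have h2 : y ^ 2 ≤ 2 * (q ^ 2 * w ^ 2) + 2 * ((μ * p + r) / (4 / 5 * a)) ^ 2 := by
      have h3 : y ^ 2 ≤ (q * w + (μ * p + r) / (4 / 5 * a)) ^ 2 := pow_le_pow_left₀ hy0 h1 2
      linarith [sq_nonneg (q * w - (μ * p + r) / (4 / 5 * a)),
        add_sq (q * w) ((μ * p + r) / (4 / 5 * a)), sub_sq (q * w) ((μ * p + r) / (4 / 5 * a)),
        mul_pow q w 2]
    have h3 : a * (2 * ((μ * p + r) / (4 / 5 * a)) ^ 2) = 25 / 8 / a * (μ * p + r) ^ 2 := by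
      field_simp
      ring
    have h4 : 25 / 8 / a * (μ * p + r) ^ 2 ≤ 25 / 8 / g * (2 * (μ ^ 2 * p ^ 2 + r ^ 2)) := by
      have : (μ * p + r) ^ 2 ≤ 2 * (μ ^ 2 * p ^ 2 + r ^ 2) := by
        linarith [sq_nonneg (μ * p - r), add_sq (μ * p) r, sub_sq (μ * p) r, mul_pow μ p 2]
      gcongr
    have h5 : a * (2 * (q ^ 2 * w ^ 2)) ≤ L * (2 * (q ^ 2 * w ^ 2)) := by gcongr
    have h6 := mul_le_mul_of_nonneg_left h2 ha0.le
    have h7 : 25 / 8 / g * (2 * (μ ^ 2 * p ^ 2 + r ^ 2)) =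
        25 / 4 / g * (μ ^ 2 * p ^ 2 + r ^ 2) := by ring
    have h8 : 0 ≤ m * y ^ 2 := by positivity
    linarith

/-- If the norms remain close to `‖s‖` for `k ≥ log v / (ημ)` steps, where `v` is the initial
accuracy relative to `ε`, then the accuracy `ε` is reached, even though the lowest eigenvalue `m`
of `T + ρ‖s‖` may be tiny, because the other eigenvalues are at least `g ≫ μ`. -/
theorem IsDescent.cubic_sub_le_of_gap (h : IsDescent T β b ρ η B x)
    (hT : ∀ i x, inner ℝ (u i) (T x) = l i * inner ℝ (u i) x) {s : E} (hs0 : s ≠ 0)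
    {ε μ g m : ℝ} (hε : 0 < ε)
    (hμ : 0 < μ) (hη : 4 * (η * (β + ρ * ‖s‖)) ≤ 1) (hv : 2 * ε ≤ (β + 2 * ρ * ‖s‖) * ‖s‖ ^ 2)
    (hμg : 10 * ‖s‖ ^ 2 * μ ^ 2 = ε * g) (hg : 16 * ε ≤ 10 * ‖s‖ ^ 2 * g) (hgs : g ≤ ρ * ‖s‖)
    (hm : 0 ≤ m) (hmε : 10 * ‖s‖ ^ 2 * m ≤ ε)
    (hgap : ∀ i, l i + ρ * ‖s‖ = m ∨ g ≤ l i + ρ * ‖s‖) (t k : ℕ)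
    (hnt : IsNear T b ρ ε s (x t)) (hnk : IsNear T b ρ ε s (x (t + k)))
    (hh : ∀ j, t ≤ j → j ≤ t + k → ρ * (‖x j‖ - ‖s‖) ≤ μ ∧ ρ * (‖s‖ - ‖x j‖) ≤ 13 / 20 * μ)
    (hk : Real.log ((β + 2 * ρ * ‖s‖) * ‖s‖ ^ 2 / ε) ≤ η * μ * k) :
    cubic T b ρ (x (t + k)) - cubic T b ρ s ≤ ε := by
  have hρ := h.rho_pos
  have hη0 := h.eta_pos
  have hn : 0 < ‖s‖ := norm_pos_iff.2 hs0
  have hβ0 := (norm_nonneg T).trans h.opNorm_le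
  have hg0 : 0 < g := by
    by_contra hneg
    push Not at hneg
    nlinarith [mul_nonneg (sq_nonneg ‖s‖) (neg_nonneg.2 hneg)]
  have h4μ : 4 * μ ≤ g := by
    refine abs_le_of_sq_le_sq' ?_ hg0.le |>.2
    have : 10 * ‖s‖ ^ 2 * (4 * μ) ^ 2 ≤ 10 * ‖s‖ ^ 2 * g ^ 2 := by nlinarith
    exact le_of_mul_le_mul_left this (by positivity)
  set L := β + 2 * ρ * ‖s‖ with hL
  have hL0 : 0 < L := by positivity
  set v := L * ‖s‖ ^ 2 / ε with hvdef
  have hv2 : 2 ≤ v := by rw [hvdef, le_div_iff₀ hε]; exact hv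
  have hv0 : 0 < v := by linarith
  set q := Real.exp (-(3 * (η * μ))) ^ k with hq
  have hq0 : 0 ≤ q := by positivity
  -- Contraction at rate 3ημ over k ≥ log v/(ημ) steps gives q ≤ v⁻³, hence q²v ≤ v⁻⁵ ≤ 2⁻⁵.
  have hqv : q * v ^ 3 ≤ 1 := by
    have h1 : q = Real.exp (-(η * μ * k)) ^ 3 := by
      rw [hq, ← Real.exp_nat_mul, ← Real.exp_nat_mul]
      congr 1
      push_cast
      ring
    rw [h1, ← mul_pow]
    refine pow_le_one₀ (by positivity) ?_
    calc Real.exp (-(η * μ * k)) * v ≤ Real.exp (-Real.log v) * v := by gcongr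
      _ = 1 := by rw [Real.exp_neg, Real.exp_log hv0, inv_mul_cancel₀ hv0.ne']
  have hqv2 : q ^ 2 * v ≤ 1 / 32 := by
    have h1 : (q * v ^ 3) ^ 2 ≤ 1 := pow_le_one₀ (by positivity) hqv
    have h2 : 2 ^ 5 ≤ v ^ 5 := by gcongr
    have h3 : 0 ≤ q ^ 2 * v := by positivity
    nlinarith [mul_le_mul_of_nonneg_left h2 h3]
  set y := x (t + k) with hy
  have hterm := h.coord_sq_le_of_gap hT hμ hη hg0 h4μ hm hgap t k fun j h1 h2 => hh j h1 h2.le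
  rw [← hq, ← hy] at hterm
  have hQ := shiftQuad_le_of_coord hT hterm
  -- Budget in units of ε: half of 29/128 + 3/20 + 13/20 from the shifted form, 3/50 from the norm
  -- difference, 1/15 from the gradient at s; the total is below 1.
  have b1 : m * ‖y - s‖ ^ 2 ≤ 29 / 128 * ε := by
    have : m * ‖y - s‖ ^ 2 ≤ m * (145 / 64 * ‖s‖ ^ 2) := by gcongr; exact hnk.dist_sq_le
    linarith
  have b2 : 2 * L * q ^ 2 * ‖x t - s‖ ^ 2 ≤ 3 / 20 * ε := by
    have h1 : 2 * L * q ^ 2 * ‖x t - s‖ ^ 2 ≤ 2 * L * q ^ 2 * (145 / 64 * ‖s‖ ^ 2) := by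
      gcongr; exact hnt.dist_sq_le
    have h2 : v * ε = L * ‖s‖ ^ 2 := by rw [hvdef]; field_simp
    have h3 : q ^ 2 * v * ε ≤ 1 / 32 * ε := by gcongr
    rw [mul_assoc, h2] at h3
    linarith
  have b3 : 25 / 4 / g * (μ ^ 2 * ‖s‖ ^ 2 + ‖cubicGrad T b ρ s‖ ^ 2) ≤ 13 / 20 * ε := by
    rw [div_mul_eq_mul_div, div_le_iff₀ hg0]
    have h1 : (24 * ‖cubicGrad T b ρ s‖ * ‖s‖) ^ 2 ≤ ε ^ 2 := by gcongr; exact hnt.grad_le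
    have h2 : ‖s‖ ^ 2 * (576 * ‖cubicGrad T b ρ s‖ ^ 2) ≤ ‖s‖ ^ 2 * (10 / 16 * ε * g) := by
      nlinarith
    have h3 := le_of_mul_le_mul_left h2 (by positivity)
    have : 0 < ε * g := by positivity
    linarith
  obtain ⟨h1, h2⟩ := hh (t + k) (Nat.le_add_right _ _) le_rfl
  rw [← hy] at h1 h2
  have b4 : ρ / 6 * (‖y‖ - ‖s‖) ^ 2 * (‖s‖ + 2 * ‖y‖) ≤ 3 / 50 * ε := by
    have h3 : (ρ * (‖y‖ - ‖s‖)) ^ 2 ≤ μ ^ 2 := sq_le_sq' (by linarith) h1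
    have h4 : ρ / 6 * (‖y‖ - ‖s‖) ^ 2 * (‖s‖ + 2 * ‖y‖) ≤
        ρ / 6 * (‖y‖ - ‖s‖) ^ 2 * (13 / 4 * ‖s‖) :=
      mul_le_mul_of_nonneg_left (by linarith [hnk.norm_le]) (by positivity)
    have h5 : 10 * ‖s‖ ^ 2 * (ρ * (‖y‖ - ‖s‖)) ^ 2 ≤ ε * (ρ * ‖s‖) := by
      calc 10 * ‖s‖ ^ 2 * (ρ * (‖y‖ - ‖s‖)) ^ 2 ≤ 10 * ‖s‖ ^ 2 * μ ^ 2 := by gcongr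
        _ = ε * g := hμg
        _ ≤ ε * (ρ * ‖s‖) := by gcongr
    have h6 : (ρ * ‖s‖) * (10 * (ρ * (‖y‖ - ‖s‖) ^ 2 * ‖s‖)) ≤ (ρ * ‖s‖) * ε := by linarith
    have h7 := le_of_mul_le_mul_left h6 (by positivity)
    linarith
  rw [cubic_sub_eq h.symm]
  linarith [(abs_le.1 hnk.abs_inner_grad_le).2]

end Coordinates

/-! ### Iteration counts from a convergence rate. -/

section Rates

variable {E : Type*} [NormedAddCommGroup E] [InnerProductSpace ℝ E]
  {T : E →L[ℝ] E} {β : ℝ} {b : E} {ρ η B : ℝ} {x : ℕ → E}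

/-- Linear convergence at rate `2ημ/5` reaches accuracy `ε` in `5 log v / (ημ)` steps, for an
initial relative accuracy `v ≥ 2`. -/
theorem IsDescent.cubic_sub_le_of_rate (h : IsDescent T β b ρ η B x) {s : E} {ε μ : ℝ}
    (hμ : 0 < μ) (hε : 0 < ε) (hη : 4 * (η * (β + ρ * ‖s‖)) ≤ 1)
    (hv : 2 * ε ≤ (β + 2 * ρ * ‖s‖) * ‖s‖ ^ 2) (hnear : ∀ j, IsNear T b ρ ε s (x j)) {t k : ℕ}
    (hG : ∀ j, t ≤ j → ε < cubic T b ρ (x j) - cubic T b ρ s →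
      μ * (‖x j - s‖ ^ 2 + 9 / 10 * η * gradGap T ρ s (x j)) ≤
        5 * inner ℝ (x j - s) (cubicGrad T b ρ (x j)))
    (hk : 5 * Real.log ((β + 2 * ρ * ‖s‖) * ‖s‖ ^ 2 / ε) < η * μ * k) :
    cubic T b ρ (x (t + k)) - cubic T b ρ s ≤ ε := by
  by_contra hlt
  push Not at hlt
  have hF : ∀ j, j ≤ t + k → ε < cubic T b ρ (x j) - cubic T b ρ s := fun j hj =>
    hlt.trans_le (sub_le_sub_right (h.antitone hj) _)
  have h1 := h.exp_le hμ hε hη (t := t) (k := k) (fun j _ _ => hnear j) (fun j _ hj => hF j hj)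
    (fun j h1 h2 => hG j h1 (hF j h2.le))
  set v := (β + 2 * ρ * ‖s‖) * ‖s‖ ^ 2 / ε with hvdef
  have hv2 : 2 ≤ v := by rw [hvdef, le_div_iff₀ hε]; exact hv
  -- The exponential in `h1` is at most 2v ≤ v², yet the number of steps makes it exceed v².
  have h2 : 2 * v ≤ v ^ 2 := by nlinarith
  have h3 : Real.exp (2 * Real.log v) < Real.exp (2 / 5 * (η * μ) * k) :=
    Real.exp_lt_exp.2 (by linarith)
  have h4 : Real.exp (2 * Real.log v) = v ^ 2 := by
    rw [two_mul, Real.exp_add, Real.exp_log (by linarith), sq]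
  linarith

theorem lt_log_of_two_le {v : ℝ} (hv : 2 ≤ v) : 69 / 100 < Real.log v := by
  have := Real.log_two_gt_d9
  have := Real.log_le_log two_pos hv
  linarith

theorem exists_nat_mul_between {a c : ℝ} (ha : 0 < a) (hc : 0 ≤ c) :
    ∃ k : ℕ, c ≤ a * k ∧ a * k < c + a := by
  refine ⟨⌈c / a⌉₊, ?_, ?_⟩
  · rw [mul_comm, ← div_le_iff₀ ha]
    exact Nat.le_ceil _
  · have := mul_lt_mul_of_pos_left (Nat.ceil_lt_add_one (by positivity : 0 ≤ c / a)) ha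
    rwa [mul_add, mul_one, mul_div_cancel₀ _ ha.ne'] at this

/-- Convergence for a rate `μ` which is either the lowest eigenvalue `m` of `T + ρ‖s‖` or
comparable to `ε/(10‖s‖²) ≥ m`. -/
theorem IsDescent.cubic_sub_le_of_growth (h : IsDescent T β b ρ η B x) {s : E} (hs0 : s ≠ 0)
    {ε μ m Λ : ℝ} (hμ : 0 < μ) (hε : 0 < ε) (hη : 4 * (η * (β + ρ * ‖s‖)) ≤ 1)
    (hv : 2 * ε ≤ (β + 2 * ρ * ‖s‖) * ‖s‖ ^ 2) (hnear : ∀ j, IsNear T b ρ ε s (x j))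
    (hημ : 4 * (η * μ) ≤ 1) (hm : ∀ x, m * ‖x‖ ^ 2 ≤ inner ℝ x (T x) + ρ * ‖s‖ * ‖x‖ ^ 2)
    (hμm : μ = m ∨ (10 * ‖s‖ ^ 2 * m ≤ ε ∧ ε ≤ 10 * ‖s‖ ^ 2 * μ ∧ 10 * ‖s‖ ^ 2 * μ ≤ 4 * ε))
    (hΛ : 0 ≤ Λ)
    (hgrow : ∀ δ, 0 < δ → ∀ t : ℕ, Λ + 2 * Real.log ((β + 2 * ρ * ‖s‖) * ‖s‖ ^ 2 / ε) ≤
      4 / 5 * (η * δ) * t → ρ * (‖s‖ - ‖x t‖) ≤ m + δ) {t : ℕ}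
    (ht : 6 * Λ + 14 * Real.log ((β + 2 * ρ * ‖s‖) * ‖s‖ ^ 2 / ε) ≤ η * μ * t) :
    cubic T b ρ (x t) - cubic T b ρ s ≤ ε := by
  have hρ := h.rho_pos
  have hη0 := h.eta_pos
  have hn : 0 < ‖s‖ := norm_pos_iff.2 hs0
  have hημ0 : 0 < η * μ := mul_pos hη0 hμ
  have hlog := lt_log_of_two_le ((le_div_iff₀ hε).2 hv)
  set ℓ := Real.log ((β + 2 * ρ * ‖s‖) * ‖s‖ ^ 2 / ε) with hℓ
  -- Growth with δ = 2μ/5 takes ημt₁ ≥ (25/8)(Λ + 2ℓ), and the linear phase then needs more than 5ℓ.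
  -- Rounding costs at most ημ ≤ 1/4, which fits into 6Λ + 14ℓ because ℓ > 69/100.
  obtain ⟨t₁, h1, h2⟩ := exists_nat_mul_between hημ0
    (by positivity : 0 ≤ 25 / 8 * (Λ + 2 * ℓ))
  have hle : t₁ ≤ t := by
    have : η * μ * t₁ ≤ η * μ * t := by linarith
    exact_mod_cast le_of_mul_le_mul_left this hημ0
  obtain ⟨k, rfl⟩ := Nat.exists_eq_add_of_le hle
  refine h.cubic_sub_le_of_rate hμ hε hη hv hnear ?_ ?_
  · intro j hj hF
    have hnj := hnear j
    have hW := hnj.le_gradGap hρ h.symm hF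
    have hG := hnj.le_inner_cubicGrad hρ h.symm hF
    have hQW : shiftQuad T ρ s (x j) ≤ gradGap T ρ s (x j) := IsNear.shiftQuad_le_gradGap hρ
    have hj' : ρ * (‖s‖ - ‖x j‖) ≤ m + 2 / 5 * μ := by
      refine hgrow (2 / 5 * μ) (by positivity) j ?_
      have : η * μ * t₁ ≤ η * μ * j := by gcongr
      linarith
    have hmD : m * ‖x j - s‖ ^ 2 ≤ shiftQuad T ρ s (x j) := hm (x j - s)
    have hD := hnj.dist_sq_le
    set D := ‖x j - s‖ ^ 2 with hDdef
    set W := gradGap T ρ s (x j)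
    have hD0 : 0 ≤ D := sq_nonneg _
    have hW0 : 0 ≤ W := by linarith
    have hημW : 4 * (η * μ) * W ≤ 1 * W := by gcongr
    -- For μ = m the loss is at most 7μD/10 and is absorbed through mD ≤ W. Otherwise the loss and
    -- μD are both O(ε) and are absorbed through W ≥ 42ε/25.
    rcases hμm with rfl | ⟨hm1, hm2, hm3⟩
    · have h3 : ρ / 2 * max (‖s‖ - ‖x j‖) 0 * D ≤ 7 / 10 * W := by
        have h4 : ρ * max (‖s‖ - ‖x j‖) 0 ≤ 7 / 5 * μ := by
          rw [mul_max_of_nonneg _ _ hρ.le]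
          exact max_le (by linarith) (by linarith)
        have h5 : ρ * max (‖s‖ - ‖x j‖) 0 * D ≤ 7 / 5 * μ * D := by gcongr
        linarith
      linarith
    · have h3 : ρ / 2 * max (‖s‖ - ‖x j‖) 0 * D ≤ 26 / 100 * ε := by
        rcases le_total ‖s‖ ‖x j‖ with hsx | hsx
        · rw [max_eq_right (by linarith)]
          simp only [mul_zero, zero_mul]
          positivity
        · rw [max_eq_left (by linarith)]
          have h4 : D ≤ 2 * ‖s‖ ^ 2 := by
            have h5 : ‖x j‖ ^ 2 ≤ ‖s‖ ^ 2 := by gcongr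
            rw [hDdef, norm_sub_sq_real]
            linarith [hnj.inner_nonneg]
          have h5 : ρ * (‖s‖ - ‖x j‖) * D ≤ ρ * (‖s‖ - ‖x j‖) * (2 * ‖s‖ ^ 2) :=
            mul_le_mul_of_nonneg_left h4 (mul_nonneg hρ.le (by linarith))
          have h6 : ρ * (‖s‖ - ‖x j‖) * (2 * ‖s‖ ^ 2) ≤ (m + 2 / 5 * μ) * (2 * ‖s‖ ^ 2) := by
            gcongr
          linarith
      have h4 : μ * D ≤ μ * (145 / 64 * ‖s‖ ^ 2) := by gcongr
      linarith
  · push_cast at ht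
    linarith

end Rates

/-! ### The gap-dependent rate. -/

section Gap

variable {E ι : Type*} [NormedAddCommGroup E] [InnerProductSpace ℝ E] [Fintype ι]
  {T : E →L[ℝ] E} {u : OrthonormalBasis ι ℝ E} {l : ι → ℝ} {β : ℝ} {b : E} {ρ η B : ℝ} {x : ℕ → E}

/-- Convergence at the rate `√(ε g / (10 ‖s‖²))` given by a gap `g` above the lowest
eigenvalue. -/
theorem IsDescent.cubic_sub_le_of_growth_of_gap (h : IsDescent T β b ρ η B x)
    (hT : ∀ i x, inner ℝ (u i) (T x) = l i * inner ℝ (u i) x) {s : E} (hs0 : s ≠ 0)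
    {ε μ g m Λ : ℝ} (hμ : 0 < μ) (hε : 0 < ε) (hη : 4 * (η * (β + ρ * ‖s‖)) ≤ 1)
    (hv : 2 * ε ≤ (β + 2 * ρ * ‖s‖) * ‖s‖ ^ 2) (hnear : ∀ j, IsNear T b ρ ε s (x j))
    (hm0 : 0 ≤ m) (hmε : 10 * ‖s‖ ^ 2 * m ≤ ε)
    (hμg : 10 * ‖s‖ ^ 2 * μ ^ 2 = ε * g) (hg0 : 0 < g) (hgs : g ≤ ρ * ‖s‖)
    (hgap : ∀ i, l i + ρ * ‖s‖ = m ∨ (g ≤ l i + ρ * ‖s‖ ∧ m ≤ l i + ρ * ‖s‖))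
    (hΛ : 0 ≤ Λ)
    (hgrow : ∀ δ, 0 < δ → ∀ t : ℕ, Λ + 2 * Real.log ((β + 2 * ρ * ‖s‖) * ‖s‖ ^ 2 / ε) ≤
      4 / 5 * (η * δ) * t → ρ * (‖s‖ - ‖x t‖) ≤ m + δ) {t : ℕ}
    (ht : 6 * Λ + 14 * Real.log ((β + 2 * ρ * ‖s‖) * ‖s‖ ^ 2 / ε) ≤ η * μ * t) :
    cubic T b ρ (x t) - cubic T b ρ s ≤ ε := by
  have hρ := h.rho_pos
  have hη0 := h.eta_pos
  have hβ0 := (norm_nonneg T).trans h.opNorm_le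
  have hn : 0 < ‖s‖ := norm_pos_iff.2 hs0
  have hm : ∀ x, m * ‖x‖ ^ 2 ≤ inner ℝ x (T x) + ρ * ‖s‖ * ‖x‖ ^ 2 := by
    refine mul_norm_sq_le_inner_apply hT fun i => ?_
    rcases hgap i with hi | hi
    · exact hi.ge
    · exact hi.2
  have hηs : η * (ρ * ‖s‖) ≤ 1 / 4 := by linarith [mul_nonneg hη0.le hβ0]
  have hlog := lt_log_of_two_le ((le_div_iff₀ hε).2 hv)
  set c := 10 * ‖s‖ ^ 2 with hc
  have hc0 : 0 < c := by positivity
  -- The rate satisfies cμ² = εg. For cg ≤ ε it is at most ε/c, attainable without a gap; for ε < cg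
  -- ≤ 16ε it is between ε/c and 4ε/c, still covered by the gap-free argument; beyond that 4μ ≤ g
  -- and 4m ≤ μ, so the spectrum really separates.
  rcases le_or_gt (c * g) ε with hg1 | hg1
  · have hμ1 : μ ≤ ε / c := by
      refine abs_le_of_sq_le_sq' ?_ (by positivity) |>.2
      rw [div_pow, le_div_iff₀ (by positivity)]
      nlinarith
    have hcε : c * (ε / c) = ε := by field_simp
    refine h.cubic_sub_le_of_growth hs0 (μ := ε / c) (by positivity) hε hη hv hnear ?_ hm
      (Or.inr ⟨hmε, hcε.ge, by linarith⟩) hΛ hgrow (ht.trans (by gcongr))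
    have h1 : ε / c ≤ (β + ρ * ‖s‖) := by
      rw [div_le_iff₀ hc0, hc]
      have : 0 ≤ β * ‖s‖ ^ 2 := by positivity
      have : 0 ≤ ρ * ‖s‖ * ‖s‖ ^ 2 := by positivity
      linarith
    have h2 : η * (ε / c) ≤ η * (β + ρ * ‖s‖) := by gcongr
    linarith
  have hμg' : μ ≤ g := by
    refine abs_le_of_sq_le_sq' ?_ hg0.le |>.2
    have : c * μ ^ 2 ≤ c * g ^ 2 := by nlinarith
    exact le_of_mul_le_mul_left this hc0
  have hημ : 4 * (η * μ) ≤ 1 := by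
    have : η * μ ≤ η * (ρ * ‖s‖) := by gcongr; linarith
    linarith
  rcases le_or_gt (c * g) (16 * ε) with hg2 | hg2
  · refine h.cubic_sub_le_of_growth hs0 hμ hε hη hv hnear hημ hm
      (Or.inr ⟨hmε, ?_, ?_⟩) hΛ hgrow ht
    · refine abs_le_of_sq_le_sq' ?_ (by positivity) |>.2
      nlinarith
    · refine abs_le_of_sq_le_sq' ?_ (by positivity) |>.2
      nlinarith
  have hημ0 : 0 < η * μ := mul_pos hη0 hμ
  have hm4 : 4 * m ≤ μ := by
    have : c * (4 * m) ≤ c * μ := by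
      refine abs_le_of_sq_le_sq' ?_ (by positivity) |>.2
      have h1 : (c * m) ^ 2 ≤ ε ^ 2 := by gcongr
      nlinarith
    exact le_of_mul_le_mul_left this hc0
  set ℓ := Real.log ((β + 2 * ρ * ‖s‖) * ‖s‖ ^ 2 / ε) with hℓ
  obtain ⟨t₁, h1, h2⟩ := exists_nat_mul_between hημ0
    (by positivity : 0 ≤ 25 / 8 * (Λ + 2 * ℓ))
  obtain ⟨k₁, h3, h4⟩ := exists_nat_mul_between hημ0 (by positivity : 0 ≤ ℓ)
  have hle : t₁ + k₁ ≤ t := by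
    have : η * μ * ((t₁ + k₁ : ℕ) : ℝ) ≤ η * μ * t := by push_cast; linarith
    exact_mod_cast le_of_mul_le_mul_left this hημ0
  have hlow : ∀ j, t₁ ≤ j → ρ * (‖s‖ - ‖x j‖) ≤ 13 / 20 * μ := by
    intro j hj
    have : ρ * (‖s‖ - ‖x j‖) ≤ m + 2 / 5 * μ := by
      refine hgrow (2 / 5 * μ) (by positivity) j ?_
      have : η * μ * t₁ ≤ η * μ * j := by gcongr
      linarith
    linarith
  -- Monotone norms make this one test decisive: an overshoot at the end of the window persists
  -- forever and makes the gradient gap at least μ‖x - s‖²/2, while its absence bounds the norm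
  -- throughout the window.
  rcases le_or_gt μ (ρ * (‖x (t₁ + k₁)‖ - ‖s‖)) with hfar | hclose
  · obtain ⟨k, rfl⟩ := Nat.exists_eq_add_of_le hle
    refine h.cubic_sub_le_of_rate hμ hε hη hv hnear ?_ ?_
    · intro j hj hF
      have hnj := hnear j
      have hG := hnj.le_inner_cubicGrad hρ h.symm hF
      have hxj : μ ≤ ρ * (‖x j‖ - ‖s‖) := by
        refine hfar.trans ?_
        gcongr
        exact h.mono hj
      have hxs : 0 ≤ ‖x j‖ - ‖s‖ := by
        by_contra hneg
        push Not at hneg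
        linarith [mul_neg_of_pos_of_neg hρ hneg]
      rw [max_eq_right (by linarith), mul_zero, zero_mul, sub_zero] at hG
      have hW : μ * ‖x j - s‖ ^ 2 ≤ 2 * gradGap T ρ s (x j) := by
        have h5 : μ * ‖x j - s‖ ^ 2 ≤ ρ * (‖x j‖ - ‖s‖) * ‖x j - s‖ ^ 2 := by gcongr
        have h6 := hnj.shiftQuad_nonneg
        have h7 : 0 ≤ ρ / 2 * (‖x j‖ - ‖s‖) ^ 2 * (‖x j‖ + ‖s‖) := by positivity
        rw [gradGap, max_eq_left hxs]
        linarith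
      have hW0 : 0 ≤ gradGap T ρ s (x j) := by
        have : 0 ≤ μ * ‖x j - s‖ ^ 2 := by positivity
        linarith
      have hημW : 4 * (η * μ) * gradGap T ρ s (x j) ≤ 1 * gradGap T ρ s (x j) := by gcongr
      linarith
    · push_cast at ht
      linarith
  · refine le_trans (sub_le_sub_right (h.antitone hle) _) ?_
    refine h.cubic_sub_le_of_gap hT hs0 hε hμ hη hv hμg hg2.le hgs hm0 hmε
      (fun i => (hgap i).imp_right And.left) t₁ k₁ (hnear _) (hnear _) (fun j hj1 hj2 => ⟨?_, hlow j hj1⟩) h3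
    refine le_trans ?_ hclose.le
    gcongr
    exact h.mono hj2

end Gap

/-! ### The sign-flipped reference point for the perturbed cubic. -/

section Reference

variable {E ι : Type*} [NormedAddCommGroup E] [InnerProductSpace ℝ E] [Fintype ι]
  {T : E →L[ℝ] E} {u : OrthonormalBasis ι ℝ E} {l : ι → ℝ}

/-- Flipping the signs of the coordinates of `s` to be opposite to those of `b'`. -/
theorem exists_sign_flip (u : OrthonormalBasis ι ℝ E) (s b' : E) :
    ∃ s' : E, (∀ i, |inner ℝ (u i) s'| = |inner ℝ (u i) s|) ∧
      (∀ i, inner ℝ (u i) b' * inner ℝ (u i) s' = -(|inner ℝ (u i) b'| * |inner ℝ (u i) s|)) := by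
  classical
  set c : ι → ℝ := fun i => if inner ℝ (u i) b' ≤ 0 then |inner ℝ (u i) s| else -|inner ℝ (u i) s|
    with hc
  have hcoord : ∀ i, inner ℝ (u i) (∑ j, c j • u j) = c i := fun i =>
    u.orthonormal.inner_right_fintype c i
  refine ⟨∑ j, c j • u j, fun i => ?_, fun i => ?_⟩
  · rw [hcoord]
    by_cases h : inner ℝ (u i) b' ≤ 0 <;> simp [hc, h]
  · rw [hcoord]
    by_cases h : inner ℝ (u i) b' ≤ 0
    · simp [hc, h, abs_of_nonpos h]
    · simp [hc, h, abs_of_pos (not_le.1 h)]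

/-- For a perturbation `b'` of `b` of size `σ`, a minimizer `s` of the cubic of `b` gives a nearly
critical point `s'` of the cubic of `b'` in the orthant of the gradient descent iterates. -/
theorem exists_reference [CompleteSpace E]
    (hT : ∀ i x, inner ℝ (u i) (T x) = l i * inner ℝ (u i) x)
    {b b' s : E} {ρ σ : ℝ} (hρ : 0 < ρ) (hs : ∀ x, cubic T b ρ s ≤ cubic T b ρ x) (hs0 : s ≠ 0)
    (hb : ‖b' - b‖ ≤ σ) :
    ∃ s' : E, ‖s'‖ = ‖s‖ ∧ ‖cubicGrad T b' ρ s'‖ ≤ σ ∧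
      cubic T b' ρ s' ≤ cubic T b ρ s + σ * ‖s‖ ∧
      ∀ x, (∀ i, ∃ z, 0 ≤ z ∧ inner ℝ (u i) x = -z * inner ℝ (u i) b') → 0 ≤ inner ℝ x s' := by
  obtain ⟨s', habs, hsgn⟩ := exists_sign_flip u s b'
  have hnorm : ‖s'‖ = ‖s‖ := by
    refine (pow_left_inj₀ (norm_nonneg _) (norm_nonneg _) two_ne_zero).1 ?_
    rw [norm_sq_eq_sum_coord u, norm_sq_eq_sum_coord u s]
    exact Finset.sum_congr rfl fun i _ => by rw [← sq_abs, habs, sq_abs]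
  have hsymm := symmetric_of_coord hT
  have ha : ∀ i, 0 ≤ l i + ρ * ‖s‖ := fun i =>
    eigenvalue_add_nonneg hsymm hρ hs hs0 (u.norm_eq_one i)
      (by rw [hT, real_inner_self_eq_norm_sq, u.norm_eq_one, one_pow, mul_one])
  have hcrit : ∀ i, (l i + ρ * ‖s‖) * inner ℝ (u i) s + inner ℝ (u i) b = 0 := by
    intro i
    rw [← coord_cubicGrad hT, cubicGrad_eq_zero hsymm hρ hs, inner_zero_right]
  refine ⟨s', hnorm, ?_, ?_, fun x hx => ?_⟩
  -- Criticality of s gives |bᵢ| = (lᵢ + ρ‖s‖)|sᵢ|. As s'ᵢ opposes b'ᵢ, the gradient coordinate has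
  -- absolute value ||b'ᵢ| - |bᵢ|| ≤ |b'ᵢ - bᵢ|; both are arbitrary in sign only when s'ᵢ = 0.
  · refine le_trans ?_ hb
    refine abs_le_of_sq_le_sq' ?_ (norm_nonneg _) |>.2
    rw [norm_sq_eq_sum_coord u, norm_sq_eq_sum_coord u (b' - b)]
    refine Finset.sum_le_sum fun i _ => ?_
    rw [coord_cubicGrad hT, hnorm, inner_sub_right, sq_le_sq]
    have h1 := habs i
    have h2 := hsgn i
    have h3 := hcrit i
    have h4 := ha i
    generalize l i + ρ * ‖s‖ = a at *
    generalize inner ℝ (u i) s' = p' at *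
    generalize inner ℝ (u i) s = p at *
    generalize inner ℝ (u i) b' = c' at *
    rw [show inner ℝ (u i) b = -(a * p) by linarith]
    have h5 : |(|c'| - |-(a * p)|)| ≤ |c' - -(a * p)| := abs_abs_sub_abs_le _ _
    rw [abs_neg, abs_mul, abs_of_nonneg h4, ← h1] at h5
    rw [← h1, ← abs_mul] at h2
    refine le_of_eq_of_le ?_ h5
    have h6 : c' * p' ≤ 0 := by rw [h2]; exact neg_nonpos.2 (abs_nonneg _)
    rcases le_total 0 p' with hp | hp
    · rcases hp.eq_or_lt with rfl | hp
      · simp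
      · have : c' ≤ 0 := by
          by_contra hneg
          push Not at hneg
          linarith [mul_pos hneg hp]
        rw [abs_of_nonneg hp.le, abs_of_nonpos this, abs_sub_comm]
        congr 1; ring
    · rcases hp.eq_or_lt with rfl | hp
      · simp
      · have : 0 ≤ c' := by
          by_contra hneg
          push Not at hneg
          linarith [mul_pos_of_neg_of_neg hneg hp]
        rw [abs_of_neg hp, abs_of_nonneg this]
        congr 1; ring
  · have h1 : inner ℝ s' (T s') = inner ℝ s (T s) := by
      rw [inner_apply_eq_sum hT, inner_apply_eq_sum hT]
      exact Finset.sum_congr rfl fun i _ => by rw [← sq_abs, habs, sq_abs]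
    have h2 : inner ℝ b' s' ≤ inner ℝ b' s := by
      rw [inner_eq_sum_coord u, inner_eq_sum_coord u b']
      refine Finset.sum_le_sum fun i _ => ?_
      rw [hsgn, ← abs_mul]
      exact neg_abs_le _
    have h3 : inner ℝ b' s = inner ℝ b s + inner ℝ (b' - b) s := by
      rw [inner_sub_left]; ring
    have h4 : inner ℝ (b' - b) s ≤ σ * ‖s‖ :=
      (real_inner_le_norm _ _).trans (by gcongr)
    rw [cubic, cubic, h1, hnorm]
    linarith
  · rw [inner_eq_sum_coord u]
    refine Finset.sum_nonneg fun i _ => ?_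
    obtain ⟨z, hz, hxz⟩ := hx i
    have : -z * inner ℝ (u i) b' * inner ℝ (u i) s' = z * (|inner ℝ (u i) b'| * |inner ℝ (u i) s|) := by
      linear_combination (-z) * hsgn i
    rw [hxz, this]
    positivity

/-- Accuracy for the perturbed cubic relative to the reference point transfers to the original. -/
theorem cubic_le_of_reference {b b' s s' x : E} {ρ σ ε σbar : ℝ} (hb : ‖b' - b‖ ≤ σ)
    (hσ : 24 * σ * ‖s‖ ≤ ε * σbar) (hσ0 : 0 ≤ ε * σbar)
    (hs' : cubic T b' ρ s' ≤ cubic T b ρ s + σ * ‖s‖)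
    (hx : ‖x‖ ≤ 9 / 8 * ‖s‖) (hF : cubic T b' ρ x - cubic T b' ρ s' ≤ ε) :
    cubic T b ρ x ≤ cubic T b ρ s + (1 + σbar) * ε := by
  have h1 : cubic T b ρ x = cubic T b' ρ x - inner ℝ (b' - b) x := by
    simp only [cubic, inner_sub_left]; ring
  have h2 := (abs_le.1 (abs_real_inner_le_norm (b' - b) x)).1
  have hσ' : 0 ≤ σ := (norm_nonneg _).trans hb
  have h3 : ‖b' - b‖ * ‖x‖ ≤ σ * (9 / 8 * ‖s‖) := by gcongr
  linarith

end Reference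

/-! ### Matrices, eigengap and radii; the deterministic iteration bounds. -/

theorem objective_eq_cubic {d : ℕ} (A : Matrix (Fin d) (Fin d) ℝ)
    (b : EuclideanSpace ℝ (Fin d)) (ρ : ℝ) :
    objective A b ρ = cubic (Matrix.toEuclideanCLM (𝕜 := ℝ) A) b ρ := rfl

theorem coord_toEuclideanCLM {d : ℕ} {A : Matrix (Fin d) (Fin d) ℝ} (hA : A.IsHermitian)
    (i : Fin d) (x : EuclideanSpace ℝ (Fin d)) :
    inner ℝ (hA.eigenvectorBasis i) (Matrix.toEuclideanCLM (𝕜 := ℝ) A x)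
      = hA.eigenvalues i * inner ℝ (hA.eigenvectorBasis i) x := by
  have h1 : inner ℝ (hA.eigenvectorBasis i) (Matrix.toEuclideanCLM (𝕜 := ℝ) A x) =
      inner ℝ (Matrix.toEuclideanCLM (𝕜 := ℝ) A (hA.eigenvectorBasis i)) x := by
    have h2 := ContinuousLinearMap.adjoint_inner_left (Matrix.toEuclideanCLM (𝕜 := ℝ) A) x
      (hA.eigenvectorBasis i)
    rw [← h2, ← ContinuousLinearMap.star_eq_adjoint, ← map_star, Matrix.star_eq_conjTranspose,
      hA.eq]
  have h3 : Matrix.toEuclideanCLM (𝕜 := ℝ) A (hA.eigenvectorBasis i) =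
      hA.eigenvalues i • hA.eigenvectorBasis i := by
    ext j
    have := congrFun (hA.mulVec_eigenvectorBasis i) j
    simpa [Matrix.ofLp_toEuclideanCLM] using this
  rw [h1, h3, real_inner_smul_left]

theorem exists_eigenvalue_eq_neg_gamma {d : ℕ} [Nonempty (Fin d)] {A : Matrix (Fin d) (Fin d) ℝ}
    (hA : A.IsHermitian) :
    ∃ i, hA.eigenvalues i = -gamma A ∧ ∀ j, -gamma A ≤ hA.eigenvalues j := by
  have h1 : minEigenvalue A = sInf (Set.range hA.eigenvalues) := by
    rw [minEigenvalue, hA.spectrum_real_eq_range_eigenvalues]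
  have hfin : (Set.range hA.eigenvalues).Finite := Set.finite_range _
  obtain ⟨i, hi⟩ := (Set.range_nonempty hA.eigenvalues).csInf_mem hfin
  refine ⟨i, ?_, fun j => ?_⟩
  · rw [gamma, neg_neg, h1, hi]
  · rw [gamma, neg_neg, h1]
    exact csInf_le hfin.bddBelow ⟨j, rfl⟩

/-- The spectrum is finite, so the infimum is attained or, over the empty set, equal to ∞. The cap
ρ‖s‖ keeps the minimum finite, so `toReal` does not collapse ∞ to 0. -/
theorem gapMin_pos {d : ℕ} {A : Matrix (Fin d) (Fin d) ℝ} (hA : A.IsHermitian) {ρ : ℝ}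
    {s : EuclideanSpace ℝ (Fin d)} (hs : 0 < ρ * ‖s‖) : 0 < gapMin A ρ s := by
  rw [gapMin, ENNReal.toReal_pos_iff]
  refine ⟨lt_min ?_ (ENNReal.ofReal_pos.2 hs), (min_le_right _ _).trans_lt ENNReal.ofReal_lt_top⟩
  have hfin : {μ : ℝ | μ ∈ spectrum ℝ A ∧ minEigenvalue A < μ}.Finite := by
    refine Set.Finite.subset (s := spectrum ℝ A) ?_ fun μ h => h.1
    rw [hA.spectrum_real_eq_range_eigenvalues]
    exact Set.finite_range _
  rw [eigengap]
  by_contra hle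
  rw [not_lt, nonpos_iff_eq_zero] at hle
  rcases Set.eq_empty_or_nonempty {μ : ℝ | μ ∈ spectrum ℝ A ∧ minEigenvalue A < μ} with he | hne
  · simp [he] at hle
  · obtain ⟨μ, hμ, hmin⟩ := Set.exists_min_image _ id hfin hne
    have h1 : ENNReal.ofReal (μ - minEigenvalue A) ≤
        ⨅ μ ∈ {μ : ℝ | μ ∈ spectrum ℝ A ∧ minEigenvalue A < μ},
          ENNReal.ofReal (μ - minEigenvalue A) :=
      le_iInf₂ fun ν hν => ENNReal.ofReal_le_ofReal (sub_le_sub_right (hmin ν hν) _)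
    rw [hle, nonpos_iff_eq_zero, ENNReal.ofReal_eq_zero] at h1
    linarith [hμ.2]

theorem gapMin_le {d : ℕ} (A : Matrix (Fin d) (Fin d) ℝ) {ρ : ℝ}
    {s : EuclideanSpace ℝ (Fin d)} (hs : 0 < ρ * ‖s‖) : gapMin A ρ s ≤ ρ * ‖s‖ := by
  rw [gapMin]
  exact ENNReal.toReal_le_of_le_ofReal hs.le (min_le_right _ _)

theorem gapMin_le_eigenvalue_add {d : ℕ} {A : Matrix (Fin d) (Fin d) ℝ} (hA : A.IsHermitian)
    {ρ : ℝ} (s : EuclideanSpace ℝ (Fin d)) (i : Fin d) (hi : -gamma A < hA.eigenvalues i) :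
    gapMin A ρ s ≤ hA.eigenvalues i + gamma A := by
  rw [gapMin]
  refine ENNReal.toReal_le_of_le_ofReal (by linarith) ((min_le_left _ _).trans ?_)
  rw [gamma, neg_neg] at hi
  rw [eigengap, gamma, ← sub_eq_add_neg]
  refine iInf₂_le (hA.eigenvalues i) ⟨?_, hi⟩
  rw [hA.spectrum_real_eq_range_eigenvalues]
  exact ⟨i, rfl⟩

/-- On the ray the pairing is rρ(r² + 2pr - ‖b‖/ρ), and the Cauchy radius is the nonnegative root of
the quadratic factor. -/
theorem inner_cauchy_point_nonpos {E : Type*} [NormedAddCommGroup E] [InnerProductSpace ℝ E]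
    (T : E →L[ℝ] E) (b : E) {ρ r : ℝ} (hρ : 0 < ρ) (hr : 0 ≤ r)
    (hrc : r ≤ -inner ℝ b (T b) / (2 * ρ * ‖b‖ ^ 2) +
      Real.sqrt ((inner ℝ b (T b) / (2 * ρ * ‖b‖ ^ 2)) ^ 2 + ‖b‖ / ρ)) :
    inner ℝ (-((r / ‖b‖) • b)) (cubicGrad T b ρ (-((r / ‖b‖) • b))) ≤ 0 := by
  rcases eq_or_ne b 0 with rfl | hb
  · simp
  have hn : 0 < ‖b‖ := norm_pos_iff.2 hb
  set p := inner ℝ b (T b) / (2 * ρ * ‖b‖ ^ 2) with hp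
  rw [neg_div, ← hp] at hrc
  have hq : inner ℝ b (T b) = p * (2 * ρ * ‖b‖ ^ 2) := by rw [hp]; field_simp
  have h1 : r * (r + 2 * p) ≤ r * 0 ∨ r ^ 2 + 2 * p * r ≤ ‖b‖ / ρ := by
    rcases le_or_gt 0 (r + p) with h | h
    · right
      have h3 : (r + p) ^ 2 ≤ p ^ 2 + ‖b‖ / ρ := by
        rw [← Real.le_sqrt h (by positivity)]
        linarith
      linarith
    · left
      gcongr
      linarith
  have h2 : r ^ 2 + 2 * p * r ≤ ‖b‖ / ρ := by
    rcases h1 with h1 | h1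
    · have : 0 ≤ ‖b‖ / ρ := by positivity
      linarith
    · exact h1
  have hnorm : ‖(r / ‖b‖) • b‖ = r := by
    rw [norm_smul, Real.norm_of_nonneg (by positivity), div_mul_cancel₀ _ hn.ne']
  have h3 : inner ℝ (-((r / ‖b‖) • b)) (cubicGrad T b ρ (-((r / ‖b‖) • b))) =
      r * ρ * (r ^ 2 + 2 * p * r - ‖b‖ / ρ) := by
    rw [cubicGrad, norm_neg, hnorm]
    simp only [map_neg, map_smul, inner_add_right, inner_neg_left, inner_neg_right, smul_neg,
      real_inner_smul_left, real_inner_smul_right, hq, real_inner_self_eq_norm_sq, hnorm]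
    field_simp
    ring
  rw [h3]
  exact mul_nonpos_of_nonneg_of_nonpos (by positivity) (by linarith)

theorem radius_eq {d : ℕ} (A : Matrix (Fin d) (Fin d) ℝ) (b : EuclideanSpace ℝ (Fin d))
    {ρ : ℝ} (hρ : 0 < ρ) : beta A * radius A b ρ + ‖b‖ = ρ * radius A b ρ ^ 2 := by
  have h1 : 0 ≤ (beta A / (2 * ρ)) ^ 2 + ‖b‖ / ρ := by positivity
  have h2 := Real.sq_sqrt h1
  rw [radius]
  set w := Real.sqrt ((beta A / (2 * ρ)) ^ 2 + ‖b‖ / ρ)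
  have h3 : beta A = beta A / (2 * ρ) * (2 * ρ) := by field_simp
  have h4 : ‖b‖ = ‖b‖ / ρ * ρ := by field_simp
  generalize beta A / (2 * ρ) = p at *
  rw [h3]
  nth_rewrite 1 [h4]
  linear_combination (-ρ) * h2

theorem norm_le_radius {d : ℕ} {A : Matrix (Fin d) (Fin d) ℝ} {b s : EuclideanSpace ℝ (Fin d)}
    {ρ : ℝ} (hρ : 0 < ρ) (hs : cubicGrad (Matrix.toEuclideanCLM (𝕜 := ℝ) A) b ρ s = 0) :
    ‖s‖ ≤ radius A b ρ := by
  have h1 : ρ * ‖s‖ ^ 2 ≤ beta A * ‖s‖ + ‖b‖ := by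
    have h2 : (ρ * ‖s‖) • s = -(Matrix.toEuclideanCLM (𝕜 := ℝ) A s + b) :=
      eq_neg_of_add_eq_zero_right hs
    have h3 : ‖(ρ * ‖s‖) • s‖ = ρ * ‖s‖ ^ 2 := by
      rw [norm_smul, Real.norm_of_nonneg (by positivity)]; ring
    rw [← h3, h2, norm_neg]
    exact (norm_add_le _ _).trans (add_le_add ((Matrix.toEuclideanCLM (𝕜 := ℝ) A).le_opNorm s) le_rfl)
  rw [radius, ← sub_le_iff_le_add']
  refine Real.le_sqrt_of_sq_le ?_
  have h3 : beta A = beta A / (2 * ρ) * (2 * ρ) := by field_simp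
  rw [h3] at h1
  generalize beta A / (2 * ρ) = p at *
  have h5 : ‖s‖ ^ 2 - p * 2 * ‖s‖ ≤ ‖b‖ / ρ := by
    rw [le_div_iff₀ hρ]
    linarith
  linarith

/-- The growth condition, from the lower bound on the coordinate of the perturbed linear term. -/
theorem log_growth_le {γ ρ n L ε δ σbar σ θ e : ℝ} (hγ : 0 < γ) (hρ : 0 < ρ) (hγn : γ ≤ ρ * n)
    (hL : 0 < L) (hε : 0 < ε) (hδ : 0 < δ) (hσbar : 0 < σbar) (he : 0 < e)
    (hσ : σ = ρ * ε / L * (σbar / 12)) (hθ : θ = σ * δ / (2 * e)) (hv : 2 ≤ L * n ^ 2 / ε) :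
    Real.log (1 + γ ^ 2 / (4 * ρ * θ)) ≤
      Real.log (1 + 3 * e / (σbar * δ)) + 2 * Real.log (L * n ^ 2 / ε) := by
  set v := L * n ^ 2 / ε with hvdef
  have hv0 : 0 < v := by linarith
  set a := 3 * e / (σbar * δ) with ha
  have ha0 : 0 < a := by positivity
  -- The constants of σ and θ leave a factor 6 = 3 · 2; the 3 belongs to a, and the 2 is absorbed by
  -- 2v ≤ v².
  have h1 : γ ^ 2 / (4 * ρ * θ) = a * (2 * (L / ε * (γ / ρ) ^ 2)) := by
    rw [hθ, hσ, ha]; field_simp; ring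
  have h2 : (γ / ρ) ^ 2 ≤ n ^ 2 := by
    gcongr
    rw [div_le_iff₀ hρ]; linarith
  have h3 : L / ε * (γ / ρ) ^ 2 ≤ v := by
    rw [hvdef, mul_div_right_comm]; gcongr
  have h4 : 1 + γ ^ 2 / (4 * ρ * θ) ≤ (1 + a) * v ^ 2 := by
    rw [h1]
    have h5 : a * (2 * (L / ε * (γ / ρ) ^ 2)) ≤ a * v ^ 2 := by
      gcongr
      nlinarith
    nlinarith
  have h5 : 0 < θ := by rw [hθ, hσ]; positivity
  calc Real.log (1 + γ ^ 2 / (4 * ρ * θ)) ≤ Real.log ((1 + a) * v ^ 2) :=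
        Real.log_le_log (by positivity) h4
    _ = Real.log (1 + a) + 2 * Real.log v := by
        rw [Real.log_mul (by positivity) (by positivity), Real.log_pow]
        push_cast; ring

/-- Converts a bound on t into a budget for ημt; the surplus factor 1 + σ̄ is simply discarded. -/
theorem le_mul_of_bound_le {η σbar X F μ t : ℝ} (hη : 0 < η) (hσ : 0 < σbar) (hX : 0 ≤ X)
    (hμ : 0 < μ) (hF : F * μ = 1) (ht : (1 + σbar) / η * X * F ≤ t) : X ≤ η * μ * t := by
  have h1 : η * μ * ((1 + σbar) / η * X * F) ≤ η * μ * t := by gcongr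
  have h2 : η * μ * ((1 + σbar) / η * X * F) = (1 + σbar) * X := by
    calc η * μ * ((1 + σbar) / η * X * F) = (1 + σbar) * X * (F * μ) := by field_simp
      _ = (1 + σbar) * X := by rw [hF, mul_one]
  nlinarith

set_option maxHeartbeats 1000000 in
/-- The two iteration bounds, for a fixed perturbation of `b` whose coordinate along the lowest
eigenvector is bounded below. -/
theorem gradientDescent_accuracy {d : ℕ} [Nonempty (Fin d)] {A : Matrix (Fin d) (Fin d) ℝ}
    (hA : A.IsHermitian) {b s : EuclideanSpace ℝ (Fin d)} {ρ : ℝ} (hρ : 0 < ρ)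
    (hs : ∀ x, objective A b ρ s ≤ objective A b ρ x) {η : ℝ} (hη : 0 < η)
    (hηR : η ≤ 1 / (4 * (beta A + ρ * radius A b ρ))) {ε δ σbar : ℝ} (hε : 0 < ε)
    (hε' : ε ≤ (1 / 2) * beta A * ‖s‖ ^ 2 + ρ * ‖s‖ ^ 3) (hδ : 0 < δ) (hσ : 0 < σbar)
    (hσ' : σbar ≤ 1) {b' : EuclideanSpace ℝ (Fin d)} (hb : ‖b' - b‖ ≤ pertSize A ρ s ε σbar)
    {i : Fin d} (hi : hA.eigenvalues i = -gamma A)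
    (hb' : 0 < gamma A → pertSize A ρ s ε σbar * δ / (2 * Real.sqrt d) ≤
      |inner ℝ (hA.eigenvectorBasis i) b'|)
    {r : ℝ} (hr : 0 ≤ r) (hrc : r ≤ cauchyRadius A b' ρ) :
    (∀ t : ℕ, iterBound A ρ s η ε δ σbar ≤ t →
      objective A b ρ (gdIterate A b' ρ η r t) ≤ objective A b ρ s + (1 + σbar) * ε) ∧
    (ρ * ‖s‖ - gamma A ≤ (1 - 2 * σbar / 3) * (ε / (10 * ‖s‖ ^ 2)) →
      ∀ t : ℕ, gapIterBound A ρ s η ε δ σbar ≤ t →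
        objective A b ρ (gdIterate A b' ρ η r t) ≤ objective A b ρ s + (1 + σbar) * ε) := by
  have hs0 : s ≠ 0 := by
    rintro rfl
    simp at hε'
    linarith
  have hn : 0 < ‖s‖ := norm_pos_iff.2 hs0
  have hT := coord_toEuclideanCLM hA
  have hsymm := symmetric_of_coord hT
  simp only [objective_eq_cubic] at hs ⊢
  have hcrit := cubicGrad_eq_zero hsymm hρ hs
  have hsR := norm_le_radius hρ hcrit
  have hR := radius_eq A b hρ
  set R := radius A b ρ
  have hβ0 : 0 ≤ beta A := norm_nonneg _
  have hTβ : ‖Matrix.toEuclideanCLM (𝕜 := ℝ) A‖ ≤ beta A := le_rfl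
  set T := Matrix.toEuclideanCLM (𝕜 := ℝ) A with hTdef
  have hR0 : 0 < R := hn.trans_le hsR
  have hηR' : 4 * (η * (beta A + ρ * R)) ≤ 1 := by
    rw [le_div_iff₀ (by positivity)] at hηR
    linarith
  have hηn : 4 * (η * (beta A + ρ * ‖s‖)) ≤ 1 := by
    refine le_trans ?_ hηR'
    gcongr
  set L := beta A + 2 * ρ * ‖s‖ with hL
  have hL0 : 0 < L := by positivity
  have hv : 2 * ε ≤ L * ‖s‖ ^ 2 := by rw [hL]; linarith
  have hv2 : 2 ≤ L * ‖s‖ ^ 2 / ε := (le_div_iff₀ hε).2 hv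
  have hlog := lt_log_of_two_le hv2
  set σ := pertSize A ρ s ε σbar with hσdef
  have hσdef' : σ = ρ * ε / L * (σbar / 12) := rfl
  have hσ0 : 0 < σ := by rw [hσdef']; positivity
  have hσL : 12 * L * σ = ρ * (ε * σbar) := by rw [hσdef']; field_simp
  have hσn : 24 * σ * ‖s‖ ≤ ε * σbar := by
    have h1 : 12 * (2 * ρ * ‖s‖) * σ ≤ 12 * L * σ := by gcongr; rw [hL]; linarith
    have h2 : ρ * (24 * σ * ‖s‖) ≤ ρ * (ε * σbar) := by linarith
    exact le_of_mul_le_mul_left h2 hρ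
  have hεσ : ε * σbar ≤ ε := by nlinarith
  have hσn2 : 24 * σ ≤ ρ * ‖s‖ ^ 2 := by
    have h1 : ρ * (2 * (ε * σbar)) ≤ ρ * (L * ‖s‖ ^ 2) :=
      mul_le_mul_of_nonneg_left (by linarith) hρ.le
    have h2 : L * (24 * σ) ≤ L * (ρ * ‖s‖ ^ 2) := by linarith
    exact le_of_mul_le_mul_left h2 hL0
  have ha : ∀ j, 0 ≤ hA.eigenvalues j + ρ * ‖s‖ := fun j =>
    eigenvalue_add_nonneg hsymm hρ hs hs0 (hA.eigenvectorBasis.norm_eq_one j)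
      (by rw [hT, real_inner_self_eq_norm_sq, OrthonormalBasis.norm_eq_one, one_pow, mul_one])
  have hmin : ∀ j, -gamma A ≤ hA.eigenvalues j := by
    obtain ⟨_, _, h⟩ := exists_eigenvalue_eq_neg_gamma hA
    exact h
  set x := gdIterate A b' ρ η r with hx
  have hstep : ∀ t, x (t + 1) = x t - η • cubicGrad T b' ρ (x t) := by
    intro t
    have h1 : gradient (objective A b' ρ) (x t) = cubicGrad T b' ρ (x t) :=
      (hasGradientAt_cubic hsymm b' hρ (x t)).gradient
    rw [← h1]
    rfl
  have hx0 : x 0 = -((r / ‖b'‖) • b') := rfl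
  -- Enlarging R by a tenth leaves room for the perturbation, as σ ≤ ρR²/24, and the step size still
  -- fits because 3 · 11/10 ≤ 4.
  have hbB : beta A * (11 / 10 * R) + ‖b'‖ ≤ ρ * (11 / 10 * R) ^ 2 := by
    have h1 : ‖b'‖ ≤ ‖b‖ + σ := by
      have := norm_le_norm_add_norm_sub' b' b
      linarith
    have h2 : ρ * ‖s‖ ^ 2 ≤ ρ * R ^ 2 := by gcongr
    have h3 : 0 ≤ beta A * R := by positivity
    have h4 := norm_nonneg b
    linarith
  have hηB : 3 * (η * (beta A + ρ * (11 / 10 * R))) ≤ 1 := by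
    have : 0 ≤ η * beta A := by positivity
    linarith
  have hmono := gradientDescent_norm_mono hT hTβ hρ hη (by positivity : 0 < 11 / 10 * R) hbB hηB
    (by positivity : 0 ≤ r / ‖b'‖) hx0
    (by rw [hx0]; exact inner_cauchy_point_nonpos T b' hρ hr hrc) hstep
  have hdesc : IsDescent T (beta A) b' ρ η (11 / 10 * R) x :=
    ⟨hsymm, hTβ, hρ, hη, hηB, hstep, fun t => (hmono t).1,
      monotone_nat_of_le_succ fun t => (hmono t).2.1⟩
  obtain ⟨s', hs'n, hs'g, hs'f, hs'i⟩ := exists_reference hT hρ hs hs0 hb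
  have hs'0 : s' ≠ 0 := by rw [← norm_ne_zero_iff, hs'n]; exact hn.ne'
  have hpsd : ∀ y, 0 ≤ inner ℝ y (T y) + ρ * ‖s'‖ * ‖y‖ ^ 2 := by
    intro y
    have := mul_norm_sq_le_inner_apply hT ha y
    rwa [zero_mul, ← hs'n] at this
  have hxn := hdesc.norm_le_of_nearly_critical hs'0 hpsd hs'g (by rwa [hs'n])
  have hnear : ∀ j, IsNear T b' ρ ε s' (x j) := by
    refine fun j => ⟨hpsd, ?_, hxn j, hs'i _ (hmono j).2.2⟩
    rw [hs'n]
    have : 24 * ‖cubicGrad T b' ρ s'‖ * ‖s‖ ≤ 24 * σ * ‖s‖ := by gcongr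
    linarith
  have hfinal : ∀ t, cubic T b' ρ (x t) - cubic T b' ρ s' ≤ ε →
      cubic T b ρ (x t) ≤ cubic T b ρ s + (1 + σbar) * ε := fun t ht =>
    cubic_le_of_reference hb hσn (by positivity) hs'f (by rw [← hs'n]; exact hxn t) ht
  set Λ := Real.log (1 + if 0 < gamma A then 3 * Real.sqrt d / (σbar * δ) else 0) with hΛ
  have hΛ0 : 0 ≤ Λ := by
    refine Real.log_nonneg ?_
    split_ifs
    · have : 0 ≤ 3 * Real.sqrt d / (σbar * δ) := by positivity
      linarith
    · simp
  set m := ρ * ‖s‖ - gamma A with hm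
  have hm0 : 0 ≤ m := by have := ha i; rw [hi] at this; linarith
  have hmβ : m ≤ beta A + ρ * ‖s‖ := by
    have := (abs_le.1 (abs_eigenvalue_le hT hTβ i)).2
    rw [hi] at this
    linarith
  have hgrow : ∀ δ', 0 < δ' → ∀ t : ℕ, Λ + 2 * Real.log (L * ‖s‖ ^ 2 / ε) ≤
      4 / 5 * (η * δ') * t → ρ * (‖s‖ - ‖x t‖) ≤ m + δ' := by
    intro δ' hδ' t ht
    have h0 : 0 ≤ ρ * ‖x t‖ := by positivity
    rcases le_or_gt (gamma A) 0 with hγ | hγ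
    · linarith
    · have hγn : gamma A ≤ ρ * ‖s‖ := by linarith
      have hd : 0 < Real.sqrt d := by
        have : 0 < d := Fin.pos_iff_nonempty.2 inferInstance
        positivity
      have h1 := log_growth_le hγ hρ hγn hL0 hε hδ hσ hd hσdef' rfl hv2
      have hηγ : 4 * (η * gamma A) ≤ 1 := by
        have : η * gamma A ≤ η * (beta A + ρ * ‖s‖) := by gcongr; linarith
        linarith
      rw [hΛ, if_pos hγ] at ht
      have h2 := hdesc.growth hT hi hδ' hηγ (by positivity) (hb' hγ)
        (fun t => by
          obtain ⟨z, hz, hxz⟩ := (hmono t).2.2 i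
          rw [hxz]
          linarith [mul_nonneg hz (sq_nonneg (inner ℝ (hA.eigenvectorBasis i) b'))])
        (h1.trans ht)
      linarith
  have hX : 0 ≤ growTerm A δ σbar + convTerm A ρ s ε := by
    rw [growTerm, convTerm]; positivity
  have hXeq : growTerm A δ σbar + convTerm A ρ s ε =
      6 * Λ + 14 * Real.log (L * ‖s‖ ^ 2 / ε) := rfl
  have hmT : ∀ y, m * ‖y‖ ^ 2 ≤ inner ℝ y (T y) + ρ * ‖s'‖ * ‖y‖ ^ 2 :=
    mul_norm_sq_le_inner_apply hT fun j => by rw [hs'n]; linarith [hmin j]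
  refine ⟨fun t ht => hfinal t ?_, fun hsmall t ht => hfinal t ?_⟩
  · have main : ∀ μ, 0 < μ → rateFactor A ρ s ε * μ = 1 → 4 * (η * μ) ≤ 1 →
        (μ = m ∨ (10 * ‖s‖ ^ 2 * m ≤ ε ∧ ε ≤ 10 * ‖s‖ ^ 2 * μ ∧ 10 * ‖s‖ ^ 2 * μ ≤ 4 * ε)) →
        cubic T b' ρ (x t) - cubic T b' ρ s' ≤ ε := by
      intro μ hμ hrate hημ hor
      refine hdesc.cubic_sub_le_of_growth hs'0 hμ hε (by rwa [hs'n]) (by rwa [hs'n]) hnear hημ hmT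
        (by rwa [hs'n]) hΛ0 (by rwa [hs'n]) ?_
      rw [hs'n]
      exact le_mul_of_bound_le hη hσ hX hμ hrate ht
    have hμ0 : 4 * (η * (ε / (10 * ‖s‖ ^ 2))) ≤ 1 := by
      have h1 : ε / (10 * ‖s‖ ^ 2) ≤ beta A + ρ * ‖s‖ := by
        rw [div_le_iff₀ (by positivity)]
        have : 0 ≤ beta A * ‖s‖ ^ 2 := by positivity
        have : 0 ≤ ρ * ‖s‖ * ‖s‖ ^ 2 := by positivity
        linarith
      have h2 : η * (ε / (10 * ‖s‖ ^ 2)) ≤ η * (beta A + ρ * ‖s‖) := by gcongr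
      linarith
    have hslow : 10 * ‖s‖ ^ 2 * m ≤ ε → rateFactor A ρ s ε = 10 * ‖s‖ ^ 2 / ε →
        cubic T b' ρ (x t) - cubic T b' ρ s' ≤ ε := by
      intro h1 h2
      have h3 : 10 * ‖s‖ ^ 2 * (ε / (10 * ‖s‖ ^ 2)) = ε := by field_simp
      exact main (ε / (10 * ‖s‖ ^ 2)) (by positivity) (by rw [h2]; field_simp) hμ0
        (Or.inr ⟨h1, h3.ge, by linarith⟩)
    -- The case m = 0 is the convention 1/0 = +∞, where only the slow rate is available.
    rcases hm0.eq_or_lt with hm1 | hm1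
    · refine hslow (by rw [← hm1]; simpa using hε.le) ?_
      rw [rateFactor, ← hm, if_pos hm1.symm]
    · rcases le_total (1 / m) (10 * ‖s‖ ^ 2 / ε) with h1 | h1
      · refine main m hm1 ?_ ?_ (Or.inl rfl)
        · rw [rateFactor, ← hm, if_neg hm1.ne', min_eq_left h1, one_div, inv_mul_cancel₀ hm1.ne']
        · have : η * m ≤ η * (beta A + ρ * ‖s‖) := by gcongr
          linarith
      · refine hslow ?_ ?_
        · rwa [div_le_div_iff₀ hε hm1, one_mul] at h1
        · rw [rateFactor, ← hm, if_neg hm1.ne', min_eq_right h1]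
  · have hρn : 0 < ρ * ‖s‖ := mul_pos hρ hn
    have hg0 := gapMin_pos hA hρn
    have hgle := gapMin_le A hρn
    have hgap : ∀ j, hA.eigenvalues j + ρ * ‖s‖ = m ∨
        (gapMin A ρ s ≤ hA.eigenvalues j + ρ * ‖s‖ ∧ m ≤ hA.eigenvalues j + ρ * ‖s‖) := by
      intro j
      rcases (hmin j).eq_or_lt with h1 | h1
      · left; rw [← h1]; ring
      · right
        have := gapMin_le_eigenvalue_add hA (ρ := ρ) s j h1
        constructor <;> linarith
    have hbound : (1 + σbar) / η * (growTerm A δ σbar + convTerm A ρ s ε) *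
      Real.sqrt (10 * ‖s‖ ^ 2 / ε * (1 / gapMin A ρ s)) ≤ t := ht
    generalize gapMin A ρ s = g at *
    have hμsq : Real.sqrt (ε * g / (10 * ‖s‖ ^ 2)) ^ 2 = ε * g / (10 * ‖s‖ ^ 2) :=
      Real.sq_sqrt (by positivity)
    have hrate : Real.sqrt (10 * ‖s‖ ^ 2 / ε * (1 / g)) * Real.sqrt (ε * g / (10 * ‖s‖ ^ 2)) = 1 := by
      rw [← Real.sqrt_mul (by positivity), Real.sqrt_eq_one]
      field_simp
    have hμ : 0 < Real.sqrt (ε * g / (10 * ‖s‖ ^ 2)) := Real.sqrt_pos.2 (by positivity)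
    generalize Real.sqrt (ε * g / (10 * ‖s‖ ^ 2)) = μ at *
    refine hdesc.cubic_sub_le_of_growth_of_gap hT hs'0 (g := g) (m := m) hμ hε (by rwa [hs'n])
      (by rwa [hs'n]) hnear hm0 ?_ ?_ hg0 (by rwa [hs'n]) (by rwa [hs'n]) hΛ0 (by rwa [hs'n]) ?_
    · rw [hs'n]
      -- Because ‖s'‖ = ‖s‖, the margin 1 - 2σ̄/3 is needed only as a factor at most 1.
      have h1 : m ≤ ε / (10 * ‖s‖ ^ 2) := by
        refine hsmall.trans ?_
        have : 0 ≤ ε / (10 * ‖s‖ ^ 2) := by positivity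
        nlinarith
      rw [le_div_iff₀ (by positivity)] at h1
      linarith
    · rw [hs'n, hμsq]; field_simp
    · rw [hs'n]
      exact le_mul_of_bound_le hη hσ hX hμ hrate hbound

/-! ### The uniform measure of a band on the sphere. -/

section Cone

open scoped Pointwise

theorem hasDerivAt_div_sqrt (t : ℝ) :
    HasDerivAt (fun t : ℝ => t / Real.sqrt (1 + t ^ 2)) ((Real.sqrt (1 + t ^ 2))⁻¹ ^ 3) t := by
  have h0 : 0 < 1 + t ^ 2 := by positivity
  have h1 : HasDerivAt (fun t : ℝ => 1 + t ^ 2) (2 * t) t := by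
    simpa using (hasDerivAt_pow 2 t).const_add 1
  have h2 := h1.sqrt h0.ne'
  have h3 := (hasDerivAt_id t).div h2 (Real.sqrt_pos.2 h0).ne'
  refine h3.congr_deriv ?_
  have hs := Real.sq_sqrt h0.le
  have hs0 := Real.sqrt_pos.2 h0
  simp only [id]
  set w := Real.sqrt (1 + t ^ 2)
  field_simp
  linear_combination hs

/-- The integrand is the derivative of t/√(1 + t²), so the integral is the length of a subset of an
interval of length 2a. -/
theorem lintegral_inv_sqrt_pow_le (c a : ℝ) :
    ∫⁻ t in {t : ℝ | |t / Real.sqrt (1 + t ^ 2) - c| < a},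
      ENNReal.ofReal ((Real.sqrt (1 + t ^ 2))⁻¹ ^ 3) ≤ ENNReal.ofReal (2 * a) := by
  set φ := fun t : ℝ => t / Real.sqrt (1 + t ^ 2) with hφ
  set J := {t : ℝ | |φ t - c| < a} with hJ
  have hφc : Continuous φ :=
    continuous_iff_continuousAt.2 fun t => (hasDerivAt_div_sqrt t).continuousAt
  have hJm : MeasurableSet J := measurableSet_lt (by fun_prop) measurable_const
  have hinj : Function.Injective φ := by
    refine (strictMono_of_deriv_pos fun t => ?_).injective
    rw [(hasDerivAt_div_sqrt t).deriv]
    positivity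
  have h := lintegral_image_eq_lintegral_abs_deriv_mul hJm
    (fun t _ => (hasDerivAt_div_sqrt t).hasDerivWithinAt) hinj.injOn (fun _ => 1)
  simp only [mul_one, lintegral_const, Measure.restrict_apply MeasurableSet.univ,
    Set.univ_inter, one_mul] at h
  calc ∫⁻ t in J, ENNReal.ofReal ((Real.sqrt (1 + t ^ 2))⁻¹ ^ 3)
      = ∫⁻ t in J, ENNReal.ofReal |(Real.sqrt (1 + t ^ 2))⁻¹ ^ 3| := by
        refine lintegral_congr fun t => ?_
        rw [abs_of_nonneg (by positivity)]
    _ = volume (φ '' J) := h.symm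
    _ ≤ volume (Metric.ball c a) := by
        refine measure_mono ?_
        rintro _ ⟨t, ht, rfl⟩
        rw [Metric.mem_ball, Real.dist_eq]
        exact ht
    _ = ENNReal.ofReal (2 * a) := Real.volume_ball c a

/-- The part of the cone `|cos - c| < a` about an axis in the unit ball of `ℝ × F`. -/
def coneSector (F : Type*) [NormedAddCommGroup F] (c a : ℝ) : Set (ℝ × F) :=
  {p | p.1 ^ 2 + ‖p.2‖ ^ 2 < 1 ∧ |p.1 / Real.sqrt (p.1 ^ 2 + ‖p.2‖ ^ 2) - c| < a}

theorem measurableSet_coneSector {n : ℕ} (c a : ℝ) :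
    MeasurableSet (coneSector (EuclideanSpace ℝ (Fin n)) c a) := by
  have h1 : MeasurableSet {p : ℝ × EuclideanSpace ℝ (Fin n) | p.1 ^ 2 + ‖p.2‖ ^ 2 < 1} :=
    measurableSet_lt (by fun_prop) measurable_const
  have h2 : MeasurableSet {p : ℝ × EuclideanSpace ℝ (Fin n) |
      |p.1 / Real.sqrt (p.1 ^ 2 + ‖p.2‖ ^ 2) - c| < a} :=
    measurableSet_lt (by fun_prop) measurable_const
  exact h1.inter h2

/-- Substituting h = t‖y‖ turns the cosine into t/√(1 + t²) and the ball into ‖y‖ < w(t) = 1/√(1 +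
t²). Bounding the Jacobian ‖y‖ by w and integrating over y first leaves w^(n+1) times the volume of
the unit ball. For n ≥ 2, that is d > 2, this is at most w³, which integrates exactly. -/
theorem volume_coneSector_le {n : ℕ} (hn : 2 ≤ n) (c a : ℝ) :
    (volume : Measure (ℝ × EuclideanSpace ℝ (Fin n))) (coneSector _ c a) ≤
      ENNReal.ofReal (2 * a) * volume (Metric.ball (0 : EuclideanSpace ℝ (Fin n)) 1) := by
  have : Nonempty (Fin n) := ⟨⟨0, by omega⟩⟩
  set w : ℝ → ℝ := fun t => (Real.sqrt (1 + t ^ 2))⁻¹ with hw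
  have hw0 : ∀ t, 0 < w t := fun t => by positivity
  have hw1 : ∀ t, w t ≤ 1 := fun t => by
    refine inv_le_one_of_one_le₀ ?_
    rw [Real.one_le_sqrt]
    nlinarith [sq_nonneg t]
  have hwsq : ∀ t, w t ^ 2 * (1 + t ^ 2) = 1 := fun t => by
    have h0 : 0 < 1 + t ^ 2 := by positivity
    simp only [hw]
    rw [inv_pow, Real.sq_sqrt h0.le, inv_mul_cancel₀ h0.ne']
  have hwm : Measurable w := by fun_prop
  set J := {t : ℝ | |t / Real.sqrt (1 + t ^ 2) - c| < a} with hJ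
  have hJm : MeasurableSet J := measurableSet_lt (by fun_prop) measurable_const
  set S : Set (EuclideanSpace ℝ (Fin n) × ℝ) := {p | p.2 ∈ J ∧ ‖p.1‖ < w p.2} with hS
  have hSm : MeasurableSet S := by
    have h1 : MeasurableSet {p : EuclideanSpace ℝ (Fin n) × ℝ | ‖p.1‖ < w p.2} :=
      measurableSet_lt (by fun_prop) (by fun_prop)
    exact (measurable_snd hJm).inter h1
  set G : EuclideanSpace ℝ (Fin n) → ℝ → ℝ≥0∞ := fun y t =>
    S.indicator (fun p => ENNReal.ofReal (w p.2)) (y, t) with hG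
  have hGm : Measurable (Function.uncurry G) := by
    refine Measurable.indicator ?_ hSm
    fun_prop
  have hslice : ∀ y : EuclideanSpace ℝ (Fin n), y ≠ 0 →
      volume ((fun h => (h, y)) ⁻¹' coneSector (EuclideanSpace ℝ (Fin n)) c a) ≤
        ∫⁻ t, G y t := by
    intro y hy
    have hy0 : 0 < ‖y‖ := norm_pos_iff.2 hy
    set K := (fun h => (h, y)) ⁻¹' coneSector (EuclideanSpace ℝ (Fin n)) c a with hK
    have h1 := Real.volume_preimage_mul_right hy0.ne' K
    have h2 : (· * ‖y‖) ⁻¹' K = {t | (y, t) ∈ S} := by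
      ext t
      have e1 : (t * ‖y‖) ^ 2 + ‖y‖ ^ 2 = ‖y‖ ^ 2 * (1 + t ^ 2) := by ring
      have e2 : Real.sqrt (‖y‖ ^ 2 * (1 + t ^ 2)) = ‖y‖ * Real.sqrt (1 + t ^ 2) := by
        rw [Real.sqrt_mul (sq_nonneg _), Real.sqrt_sq hy0.le]
      have e3 : t * ‖y‖ / (‖y‖ * Real.sqrt (1 + t ^ 2)) = t / Real.sqrt (1 + t ^ 2) := by
        field_simp
      have e4 : ‖y‖ ^ 2 * (1 + t ^ 2) < 1 ↔ ‖y‖ < w t := by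
        have hp : 0 < 1 + t ^ 2 := by positivity
        have := (mul_lt_mul_iff_left₀ hp : ‖y‖ ^ 2 * (1 + t ^ 2) < w t ^ 2 * (1 + t ^ 2) ↔ _)
        rwa [hwsq, sq_lt_sq₀ hy0.le (hw0 t).le] at this
      simp only [hK, Set.mem_preimage, coneSector, Set.mem_ofPred_eq, e1, e2, e3, e4, hS, hJ]
      exact and_comm
    have hTm : MeasurableSet {t | (y, t) ∈ S} := measurable_prodMk_left hSm
    have h3 : volume K = ENNReal.ofReal ‖y‖ * volume {t | (y, t) ∈ S} := by
      rw [← h2, h1, ← mul_assoc, abs_of_pos (by positivity), ← ENNReal.ofReal_mul hy0.le,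
        mul_inv_cancel₀ hy0.ne', ENNReal.ofReal_one, one_mul]
    rw [h3, ← setLIntegral_const, ← lintegral_indicator hTm]
    refine lintegral_mono fun t => ?_
    simp only [hG, Set.indicator]
    by_cases ht : (y, t) ∈ S
    · simp only [Set.mem_ofPred_eq, ht, if_true]
      exact ENNReal.ofReal_le_ofReal ht.2.le
    · simp [ht]
  calc (volume : Measure (ℝ × EuclideanSpace ℝ (Fin n))) (coneSector _ c a)
      = ∫⁻ y, volume ((fun h => (h, y)) ⁻¹' coneSector (EuclideanSpace ℝ (Fin n)) c a) := by
        rw [Measure.volume_eq_prod, Measure.prod_apply_symm (measurableSet_coneSector c a)]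
    _ ≤ ∫⁻ y, ∫⁻ t, G y t := by
        refine lintegral_mono_ae ?_
        filter_upwards [compl_mem_ae_iff.2 (measure_singleton (0 : EuclideanSpace ℝ (Fin n)))]
          with y hy using hslice y hy
    _ = ∫⁻ t, ∫⁻ y, G y t := lintegral_lintegral_swap hGm.aemeasurable
    _ ≤ ∫⁻ t, J.indicator (fun t => ENNReal.ofReal (w t ^ 3) *
          volume (Metric.ball (0 : EuclideanSpace ℝ (Fin n)) 1)) t := by
        refine lintegral_mono fun t => ?_
        by_cases ht : t ∈ J
        · have h1 : ∀ y, G y t = (Metric.ball (0 : EuclideanSpace ℝ (Fin n)) (w t)).indicator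
              (fun _ => ENNReal.ofReal (w t)) y := by
            intro y
            simp only [hG, Set.indicator, hS, Set.mem_ofPred_eq, ht, true_and, mem_ball_zero_iff]
          simp only [h1, Set.indicator_of_mem ht]
          rw [lintegral_indicator measurableSet_ball, setLIntegral_const,
            Measure.addHaar_ball_of_pos _ _ (hw0 t), ← mul_assoc,
            ← ENNReal.ofReal_mul (hw0 t).le]
          refine mul_le_mul_left ?_ _
          refine ENNReal.ofReal_le_ofReal ?_
          rw [finrank_euclideanSpace_fin, ← pow_succ']
          exact pow_le_pow_of_le_one (hw0 t).le (hw1 t) (by omega)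
        · have h1 : ∀ y, G y t = 0 := by
            intro y
            simp only [hG, Set.indicator, hS, Set.mem_ofPred_eq, ht, false_and, if_false]
          simp [h1]
    _ = (∫⁻ t in J, ENNReal.ofReal (w t ^ 3)) *
          volume (Metric.ball (0 : EuclideanSpace ℝ (Fin n)) 1) := by
        rw [lintegral_indicator hJm, lintegral_mul_const _ (by fun_prop)]
    _ ≤ _ := mul_le_mul_left (lintegral_inv_sqrt_pow_le c a) _

/-- Splitting off one coordinate of an orthonormal basis. -/
noncomputable def splitCoord {E : Type*} [NormedAddCommGroup E] [InnerProductSpace ℝ E] {n : ℕ}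
    (u : OrthonormalBasis (Fin (n + 1)) ℝ E) (i : Fin (n + 1)) (x : E) :
    ℝ × EuclideanSpace ℝ (Fin n) :=
  (inner ℝ (u i) x, WithLp.toLp 2 fun j => inner ℝ (u (i.succAbove j)) x)

theorem splitCoord_norm_sq {E : Type*} [NormedAddCommGroup E] [InnerProductSpace ℝ E] {n : ℕ}
    (u : OrthonormalBasis (Fin (n + 1)) ℝ E) (i : Fin (n + 1)) (x : E) :
    (splitCoord u i x).1 ^ 2 + ‖(splitCoord u i x).2‖ ^ 2 = ‖x‖ ^ 2 := by
  rw [norm_sq_eq_sum_coord u, Fin.sum_univ_succAbove _ i, EuclideanSpace.norm_sq_eq]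
  simp [splitCoord]

theorem measurePreserving_splitCoord {E : Type*} [NormedAddCommGroup E] [InnerProductSpace ℝ E]
    [FiniteDimensional ℝ E] [MeasurableSpace E] [BorelSpace E] {n : ℕ}
    (u : OrthonormalBasis (Fin (n + 1)) ℝ E) (i : Fin (n + 1)) :
    MeasurePreserving (splitCoord u i) := by
  have h1 := u.measurePreserving_repr
  have h2 := PiLp.volume_preserving_ofLp (Fin (n + 1))
  have h3 := volume_preserving_piFinSuccAbove (fun _ : Fin (n + 1) => ℝ) i
  have h4 : MeasurePreserving (Prod.map id (@WithLp.toLp 2 (Fin n → ℝ)))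
      (volume : Measure (ℝ × (Fin n → ℝ))) volume :=
    (MeasurePreserving.id volume).prod (PiLp.volume_preserving_toLp (Fin n))
  have h5 := h4.comp (h3.comp (h2.comp h1))
  have h6 : splitCoord u i = Prod.map id (WithLp.toLp 2) ∘
      MeasurableEquiv.piFinSuccAbove (fun _ => ℝ) i ∘ WithLp.ofLp ∘ u.repr := by
    funext x
    refine Prod.ext ?_ ?_
    · exact (u.repr_apply_apply x i).symm
    · ext j
      exact (u.repr_apply_apply x (i.succAbove j)).symm
  rw [h6]
  exact h5

/-- The ball contains a cylinder of half-height 1/√(n+1) and radius 1 - 1/(2n); by Bernoulli the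
n-th power of that radius is at least 1/2. -/
theorem volume_ball_le_sqrt_mul {n : ℕ} (hn : 1 ≤ n) :
    volume (Metric.ball (0 : EuclideanSpace ℝ (Fin n)) 1) ≤
      ENNReal.ofReal (Real.sqrt (n + 1 : ℕ)) *
        volume (Metric.ball (0 : EuclideanSpace ℝ (Fin (n + 1))) 1) := by
  have hn0 : (1 : ℝ) ≤ n := by exact_mod_cast hn
  set r : ℝ := 1 - 1 / (2 * n) with hr
  set κ : ℝ := (Real.sqrt (n + 1 : ℕ))⁻¹ with hκ
  have hκ0 : 0 < κ := by positivity
  have hκsq : κ ^ 2 = 1 / (n + 1) := by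
    rw [hκ, inv_pow, Real.sq_sqrt (by positivity)]; push_cast; rw [one_div]
  have hr0 : 0 < r := by
    have : 1 / (2 * (n : ℝ)) ≤ 1 / 2 := by gcongr; linarith
    linarith
  have hrn : 1 / 2 ≤ r ^ n := by
    have h1 := one_add_mul_le_pow (a := -(1 / (2 * (n : ℝ)))) (by linarith) n
    have h2 : (n : ℝ) * -(1 / (2 * n)) = -(1 / 2) := by field_simp
    rw [h2, ← sub_eq_add_neg, ← sub_eq_add_neg, ← hr] at h1
    linarith
  have hκr : κ ^ 2 + r ^ 2 ≤ 1 := by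
    rw [hκsq, hr]
    have h1 : 1 / ((n : ℝ) + 1) + (1 - 1 / (2 * n)) ^ 2 =
        1 - (3 * n - 1) / (4 * n ^ 2 * (n + 1)) := by
      field_simp
      ring
    rw [h1]
    have : 0 ≤ (3 * (n : ℝ) - 1) / (4 * n ^ 2 * (n + 1)) := by
      apply div_nonneg <;> nlinarith
    linarith
  set u := EuclideanSpace.basisFun (Fin (n + 1)) ℝ
  have hsub : splitCoord u 0 ⁻¹' (Metric.ball (0 : ℝ) κ ×ˢ Metric.ball 0 r) ⊆
      Metric.ball (0 : EuclideanSpace ℝ (Fin (n + 1))) 1 := by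
    rintro x ⟨h1, h2⟩
    rw [mem_ball_zero_iff] at h1 h2 ⊢
    have h3 := splitCoord_norm_sq u 0 x
    have h4 : ‖(splitCoord u 0 x).1‖ ^ 2 < κ ^ 2 := by gcongr
    have h5 : ‖(splitCoord u 0 x).2‖ ^ 2 < r ^ 2 := by gcongr
    rw [Real.norm_eq_abs, sq_abs] at h4
    refine abs_lt_of_sq_lt_sq' ?_ zero_le_one |>.2
    linarith
  have hvol := measure_mono (μ := volume) hsub
  rw [(measurePreserving_splitCoord u 0).measure_preimage
    (measurableSet_ball.prod measurableSet_ball).nullMeasurableSet, Measure.volume_eq_prod,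
    Measure.prod_prod, Real.volume_ball, Measure.addHaar_ball_of_pos _ _ hr0,
    finrank_euclideanSpace_fin, ← mul_assoc, ← ENNReal.ofReal_mul (by positivity)] at hvol
  refine le_trans ?_ (mul_le_mul_right hvol _)
  rw [← mul_assoc, ← ENNReal.ofReal_mul (by positivity)]
  refine le_mul_of_one_le_left zero_le ?_
  rw [ENNReal.one_le_ofReal]
  have h1 : Real.sqrt (n + 1 : ℕ) * κ = 1 := mul_inv_cancel₀ (by positivity)
  calc (1 : ℝ) ≤ 2 * r ^ n := by linarith
    _ = Real.sqrt (n + 1 : ℕ) * κ * (2 * r ^ n) := by rw [h1, one_mul]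
    _ = _ := by ring

/-- The uniform measure of a band on the unit sphere in dimension `d ≥ 3`. -/
theorem cond_toSphere_band_le {n : ℕ} (hn : 2 ≤ n)
    (u : OrthonormalBasis (Fin (n + 1)) ℝ (EuclideanSpace ℝ (Fin (n + 1)))) (i : Fin (n + 1))
    (c a : ℝ) :
    ProbabilityTheory.cond (volume : Measure (EuclideanSpace ℝ (Fin (n + 1)))).toSphere Set.univ
      {q | |inner ℝ (u i) (q : EuclideanSpace ℝ (Fin (n + 1))) - c| < a} ≤
      ENNReal.ofReal (2 * a * Real.sqrt (n + 1 : ℕ)) := by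
  have hn1 : 1 ≤ n := by omega
  set S : Set (Metric.sphere (0 : EuclideanSpace ℝ (Fin (n + 1))) 1) :=
    {q | |inner ℝ (u i) (q : EuclideanSpace ℝ (Fin (n + 1))) - c| < a} with hS
  have hSm : MeasurableSet S := measurableSet_lt (by fun_prop) measurable_const
  -- `toSphere` is the dimension times the volume of the cone over a set, and scaling by τ does not
  -- change the cosine.
  have hsub : Set.Ioo (0 : ℝ) 1 • ((↑) '' S : Set (EuclideanSpace ℝ (Fin (n + 1)))) ⊆
      splitCoord u i ⁻¹' coneSector _ c a := by
    rintro _ ⟨τ, hτ, _, ⟨q, hq, rfl⟩, rfl⟩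
    have hqn : ‖(q : EuclideanSpace ℝ (Fin (n + 1)))‖ = 1 := by simp
    have h1 : ‖τ • (q : EuclideanSpace ℝ (Fin (n + 1)))‖ = τ := by
      rw [norm_smul, hqn, mul_one, Real.norm_of_nonneg hτ.1.le]
    have h2 := splitCoord_norm_sq u i (τ • (q : EuclideanSpace ℝ (Fin (n + 1))))
    rw [h1] at h2
    refine ⟨?_, ?_⟩
    · simp only [h2]
      nlinarith [hτ.1, hτ.2]
    · simp only [h2]
      rw [Real.sqrt_sq hτ.1.le]
      simp only [splitCoord, real_inner_smul_right]
      rw [mul_div_cancel_left₀ _ hτ.1.ne']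
      exact hq
  have hvol := measure_mono (μ := volume) hsub
  rw [(measurePreserving_splitCoord u i).measure_preimage
    (measurableSet_coneSector c a).nullMeasurableSet] at hvol
  have h3 := (hvol.trans (volume_coneSector_le hn c a)).trans
    (mul_le_mul_right (volume_ball_le_sqrt_mul hn1) _)
  have hball0 : volume (Metric.ball (0 : EuclideanSpace ℝ (Fin (n + 1))) 1) ≠ 0 :=
    (Metric.measure_ball_pos _ _ one_pos).ne'
  have hball1 : volume (Metric.ball (0 : EuclideanSpace ℝ (Fin (n + 1))) 1) ≠ ∞ :=
    measure_ball_lt_top.ne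
  rw [ProbabilityTheory.cond_apply MeasurableSet.univ, Set.univ_inter,
    Measure.toSphere_apply_univ, Measure.toSphere_apply' _ hSm, finrank_euclideanSpace_fin]
  have hd0 : ((n + 1 : ℕ) : ℝ≥0∞) ≠ 0 := by exact_mod_cast Nat.succ_ne_zero n
  have hd1 : ((n + 1 : ℕ) : ℝ≥0∞) ≠ ∞ := ENNReal.natCast_ne_top _
  rw [mul_comm, ← div_eq_mul_inv, ENNReal.div_le_iff
    (mul_ne_zero hd0 hball0) (ENNReal.mul_ne_top hd1 hball1)]
  refine (mul_le_mul_right h3 _).trans (le_of_eq ?_)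
  rw [ENNReal.ofReal_mul' (Real.sqrt_nonneg _)]
  ring

end Cone

/-! ### The random event and the conclusion. -/

theorem pertSize_pos {d : ℕ} {A : Matrix (Fin d) (Fin d) ℝ} {s : EuclideanSpace ℝ (Fin d)}
    {ρ ε σbar : ℝ} (hρ : 0 < ρ) (hε : 0 < ε)
    (hε' : ε ≤ (1 / 2) * beta A * ‖s‖ ^ 2 + ρ * ‖s‖ ^ 3) (hσ : 0 < σbar) :
    0 < pertSize A ρ s ε σbar := by
  have hβ : 0 ≤ beta A := norm_nonneg _
  have hs : 0 < ‖s‖ := by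
    refine (norm_nonneg s).lt_of_ne fun h => ?_
    rw [← h] at hε'
    norm_num at hε'
    linarith
  rw [pertSize]
  positivity

/-- A coordinate of a uniformly distributed unit vector in dimension `d ≥ 3` avoids a short
interval with high probability. -/
theorem ofReal_one_sub_le_prob_coord_avoid {d : ℕ} (hd : 2 < d)
    (u : OrthonormalBasis (Fin d) ℝ (EuclideanSpace ℝ (Fin d))) (i : Fin d) (c : ℝ) {δ : ℝ} (hδ : 0 ≤ δ)
    {Ω : Type*} [MeasurableSpace Ω] (P : Measure Ω) [IsProbabilityMeasure P]
    {q : Ω → Metric.sphere (0 : EuclideanSpace ℝ (Fin d)) 1} (hq : Measurable q)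
    (hq_unif : pdf.IsUniform q Set.univ P
      (volume : Measure (EuclideanSpace ℝ (Fin d))).toSphere) :
    ∃ E : Set Ω, MeasurableSet E ∧ ENNReal.ofReal (1 - δ) ≤ P E ∧
      ∀ ω ∈ E, δ / (2 * Real.sqrt d) ≤ |inner ℝ (u i) (q ω : EuclideanSpace ℝ (Fin d)) - c| := by
  obtain ⟨n, rfl⟩ : ∃ n, d = n + 1 := ⟨d - 1, by omega⟩
  set a : ℝ := δ / (2 * Real.sqrt (n + 1 : ℕ)) with ha
  set S : Set (Metric.sphere (0 : EuclideanSpace ℝ (Fin (n + 1))) 1) :=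
    {p | |inner ℝ (u i) (p : EuclideanSpace ℝ (Fin (n + 1))) - c| < a} with hS
  have hSm : MeasurableSet S := measurableSet_lt (by fun_prop) measurable_const
  have h1 : P (q ⁻¹' S) ≤ ENNReal.ofReal δ := by
    have h2 := cond_toSphere_band_le (n := n) (by omega) u i c a
    have h3 : 2 * a * Real.sqrt (n + 1 : ℕ) = δ := by
      rw [ha]
      have : 0 < Real.sqrt (n + 1 : ℕ) := by positivity
      field_simp
    rw [h3, ← hS] at h2
    rw [← Measure.map_apply hq hSm]
    rw [pdf.IsUniform] at hq_unif
    rwa [hq_unif]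
  refine ⟨(q ⁻¹' S)ᶜ, (hq hSm).compl, ?_, fun ω hω => not_lt.1 hω⟩
  rw [prob_compl_eq_one_sub (hq hSm)]
  rw [ENNReal.ofReal_sub _ hδ, ENNReal.ofReal_one]
  exact tsub_le_tsub_left h1 _

end CubicReg

theorem theorem2 {d : ℕ} (A : Matrix (Fin d) (Fin d) ℝ) (hA : A.IsSymm)
    (b : EuclideanSpace ℝ (Fin d)) (ρ : ℝ) (hρ : 0 < ρ)
    -- the perturbation argument needs `d > 2`, but only for non-convex objectives
    (hd : 0 < CubicReg.gamma A → 2 < d)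
    -- `s` is a global minimizer of `f`
    (s : EuclideanSpace ℝ (Fin d))
    (hs : ∀ x, CubicReg.objective A b ρ s ≤ CubicReg.objective A b ρ x)
    -- step size
    (η : ℝ) (hη : 0 < η)
    (hηR : η ≤ 1 / (4 * (CubicReg.beta A + ρ * CubicReg.radius A b ρ)))
    -- accuracy, confidence and perturbation parameters
    (ε δ σbar : ℝ) (hε : 0 < ε)
    (hε' : ε ≤ (1 / 2) * CubicReg.beta A * ‖s‖ ^ 2 + ρ * ‖s‖ ^ 3)
    (hδ : 0 < δ) (hσ : 0 < σbar) (hσ' : σbar ≤ 1)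
    -- `q` is uniformly distributed on the unit sphere
    {Ω : Type*} [MeasurableSpace Ω] (P : Measure Ω) [IsProbabilityMeasure P]
    (q : Ω → Metric.sphere (0 : EuclideanSpace ℝ (Fin d)) 1) (hq : Measurable q)
    (hq_unif : pdf.IsUniform q Set.univ P
      (volume : Measure (EuclideanSpace ℝ (Fin d))).toSphere) :
    -- an event of probability at least `1 - δ` on which everything below holds
    ∃ E : Set Ω, MeasurableSet E ∧ ENNReal.ofReal (1 - δ) ≤ P E ∧
      ∀ ω ∈ E, ∀ b' : EuclideanSpace ℝ (Fin d),
        b' = b + CubicReg.pertSize A ρ s ε σbar • (q ω : EuclideanSpace ℝ (Fin d)) →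
        ∀ r : ℝ, 0 ≤ r → r ≤ CubicReg.cauchyRadius A b' ρ →
          (∀ t : ℕ, CubicReg.iterBound A ρ s η ε δ σbar ≤ t →
            CubicReg.objective A b ρ (CubicReg.gdIterate A b' ρ η r t) ≤
              CubicReg.objective A b ρ s + (1 + σbar) * ε) ∧
          (ρ * ‖s‖ - CubicReg.gamma A ≤ (1 - 2 * σbar / 3) * (ε / (10 * ‖s‖ ^ 2)) →
            ∀ t : ℕ, CubicReg.gapIterBound A ρ s η ε δ σbar ≤ t →
              CubicReg.objective A b ρ (CubicReg.gdIterate A b' ρ η r t) ≤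
                CubicReg.objective A b ρ s + (1 + σbar) * ε) := by
  have hA' : A.IsHermitian := by
    rw [Matrix.IsHermitian, Matrix.conjTranspose_eq_transpose_of_trivial]
    exact hA
  obtain ⟨ω₀⟩ := nonempty_of_isProbabilityMeasure P
  have hne : Nonempty (Fin d) := by
    by_contra h
    rw [not_nonempty_iff] at h
    have h1 : ‖(q ω₀ : EuclideanSpace ℝ (Fin d))‖ = 1 := by simp
    rw [Subsingleton.elim (q ω₀ : EuclideanSpace ℝ (Fin d)) 0, norm_zero] at h1
    exact zero_ne_one h1
  obtain ⟨i, hi, -⟩ := CubicReg.exists_eigenvalue_eq_neg_gamma hA'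
  have hσ0 := CubicReg.pertSize_pos (A := A) hρ hε hε' hσ
  set σ := CubicReg.pertSize A ρ s ε σbar with hσdef
  set u := hA'.eigenvectorBasis
  -- Along u i the perturbed vector has coordinate σ(⟨u i, q⟩ - c) with c = -⟨u i, b⟩/σ, so the
  -- event is that q avoids a band centred at c. Without negative curvature the whole space serves.
  have hev : ∃ E : Set Ω, MeasurableSet E ∧ ENNReal.ofReal (1 - δ) ≤ P E ∧
      ∀ ω ∈ E, 0 < CubicReg.gamma A → δ / (2 * Real.sqrt d) ≤
        |inner ℝ (u i) (q ω : EuclideanSpace ℝ (Fin d)) - -inner ℝ (u i) b / σ| := by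
    by_cases hγ : 0 < CubicReg.gamma A
    · obtain ⟨E, hE, hPE, h⟩ := CubicReg.ofReal_one_sub_le_prob_coord_avoid (hd hγ) u i
        (-inner ℝ (u i) b / σ) hδ.le P hq hq_unif
      exact ⟨E, hE, hPE, fun ω hω _ => h ω hω⟩
    · refine ⟨Set.univ, MeasurableSet.univ, ?_, fun _ _ h => absurd h hγ⟩
      rw [measure_univ, ENNReal.ofReal_le_one]
      linarith
  obtain ⟨E, hE, hPE, h⟩ := hev
  refine ⟨E, hE, hPE, ?_⟩
  rintro ω hω b' rfl r hr hrc
  refine CubicReg.gradientDescent_accuracy hA' hρ hs hη hηR hε hε' hδ hσ hσ' ?_ hi ?_ hr hrc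
  · rw [add_sub_cancel_left, norm_smul, Real.norm_of_nonneg hσ0.le]
    simp [hσdef]
  · intro hγ
    have h1 := mul_le_mul_of_nonneg_left (h ω hω hγ) hσ0.le
    rw [← abs_of_pos hσ0, ← abs_mul, abs_of_pos hσ0] at h1
    rwa [mul_sub, mul_div_cancel₀ _ hσ0.ne', sub_neg_eq_add, add_comm, ← real_inner_smul_right,
      ← inner_add_right, ← mul_div_assoc] at h1
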